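/- Let $\kappa$ be an (infinite) regular ordinal. Conventions. For a category $\mathcal E$ with a class of maps $\mathcal M$ and a limit ordinal $\alpha\le\kappa$, an $\alpha$-chain in $\mathcal M$ is a diagram $D\colon\alpha\to\mathcal E$ which is cocontinuous (at limit stages $\beta<\alpha$, $D(\beta)$ is the colimit of the earlier stages) and whose successor maps are in $\mathcal M$. We say that $(\mathcal E,\mathcal M)$ *has $\kappa$-compositions* if $\mathcal M$ contains identities and is closed under binary composition and, for every limit ordinal $\alpha\le\kappa$, every $\alpha$-chain in $\mathcal M$ has a colimit, its coprojections are in $\mathcal M$, and the map out of the colimit induced by any cocone with components in $\mathcal M$ is in $\mathcal M$. We say that $(\mathcal E,\mathcal M)$ *has pushouts* if pushouts along maps in $\mathcal M$ exist and $\mathcal M$ is stable under pushout. A functor *preserves $\kappa$-compositions* (respectively *pushouts*) if it preserves the colimits of all $\alpha$-chains in $\mathcal M$, $\alpha\le\kappa$ a limit ordinal (respectively all pushouts along maps in $\mathcal M$). Let $\operatorname{ConfMon}_{\mathrm p}^{\kappa}$ be the following category. An object is a tuple $(\mathcal E,\mathcal M,T)$ of a monoidal category $(\mathcal E,I,\otimes)$,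 a class $\mathcal M$ of maps in $\mathcal E$ and a pointed object $(T,\eta\colon I\to T)$ such that: $(\mathcal E,\mathcal M)$ has $\kappa$-compositions and pushouts; the maps $X\cong I\otimes X\xrightarrow{\eta\otimes X}T\otimes X$ are in $\mathcal M$; for $f\colon A\to B$ in $\mathcal M$ the induced map $B\sqcup_A(T\otimes A)\to T\otimes B$ is in $\mathcal M$; $T\otimes(-)$ preserves $\mathcal M$ and colimits of $\kappa$-chains in $\mathcal M$; and for every $X\in\mathcal E$ the functor $(-)\otimes X$ preserves $\mathcal M$, $\kappa$-compositions and pushouts. A morphism $(\mathcal E_1,\mathcal M_1,T_1)\to(\mathcal E_2,\mathcal M_2,T_2)$ is a strong monoidal functor $P\colon\mathcal E_1\to\mathcal E_2$ with $P(\mathcal M_1)\subseteq\mathcal M_2$ that preserves $\kappa$-compositions and pushouts, together with an isomorphism $P(T_1)\cong T_2$ of pointed objects. Let $\mathrm{MonCat}$ be the category of monoidal categories and strong monoidal functors, and $\mathrm{Mon}$ the category of monoidal categories with a monoid, a morphism $(\mathcal E_1,M_1)\to(\mathcal E_2,M_2)$ being a strong monoidal functor $P$ together with an isomorphism $P(M_1)\cong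 M_2$ of monoids. **Theorem.** The canonical functor $\operatorname{ConfMon}_{\mathrm p}^{\kappa}\to\mathrm{MonCat}$ lifts through the projection $\mathrm{Mon}\to\mathrm{MonCat}$ to a functor $\operatorname{ConfMon}_{\mathrm p}^{\kappa}\to\mathrm{Mon}$ sending $(\mathcal E,\mathcal M,T)$ to $(\mathcal E,M)$ where $M$, with a map of pointed objects $\iota\colon T\to M$, is the free and algebraically-free monoid on $T$. That is: 1. (free) for every monoid $N$ in $\mathcal E$, every map of pointed objects $T\to N$ factors through $\iota$ via a unique monoid map $M\to N$; 2. (algebraically free) restriction along $\iota$ is an isomorphism from the category of objects with an $M$-action to the category of algebras of the pointed endofunctor $T\otimes(-)$, i.e. of objects $A$ with a map $T\otimes A\to A$ that restricts to the identity along $A\cong I\otimes A\to T\otimes A$; 3. (action on morphisms) for each morphism $(P,\,P(T_1)\cong T_2)$ the isomorphism $P(M_1)\cong M_2$ commutes with $P(\iota_1)$, $\iota_2$ and $P(T_1)\cong T_2$; 4. the monoid $M$ is the free monad on $T\otimes(-)$ applied to the unit: there is a free and algebraically-free monad $R$, with $\sigma\colon T\otimes(-)\to R$, on the pointed endofunctor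 $T\otimes(-)$, and an isomorphism of monads $\varphi\colon M\otimes(-)\cong R$ with $\varphi\circ(\iota\otimes(-))=\sigma$; in particular $M\cong M\otimes I\cong R(I)$. -/

import Mathlib

open CategoryTheory MonoidalCategory

universe w v u v₁ u₁ v₂ u₂ v₃ u₃

namespace FreeMonoidSequence

/-! ## Regular ordinals, transfinite compositions and pushouts in a category with a class of maps -/

/-- An (infinite) regular ordinal: one that equals its own cofinality. -/
def IsRegularOrdinal (κ : Ordinal.{w}) : Prop :=
  Ordinal.omega0 ≤ κ ∧ κ.cof.ord = κ

section Classes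

variable {E : Type u₁} [Category.{v₁} E]

/-- A diagram of shape a well-order `J` whose transfinite composition is considered for the class
of maps `M`: it is cocontinuous (the value at a limit element is the colimit of the values below)
and its successor maps lie in `M`. -/
structure IsChain (M : MorphismProperty E) {J : Type w} [LinearOrder J] (D : J ⥤ E) : Prop where
  continuous : D.IsWellOrderContinuous
  succ_mem : ∀ (a b : J) (h : a ⋖ b), M (D.map (homOfLE h.le))

/-- `(E, M)` has `κ`-compositions. Limit ordinals `α ≤ κ` are represented by the nonempty
well-orders `J` without greatest element that have order type at most `κ`. -/
structure HasCompositions (κ : Ordinal.{w}) (M : MorphismProperty E) : Prop where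
  isMultiplicative : M.IsMultiplicative
  hasColimit : ∀ (J : Type w) [LinearOrder J] [WellFoundedLT J] [Nonempty J] [NoMaxOrder J],
    Ordinal.type ((· < ·) : J → J → Prop) ≤ κ → ∀ (D : J ⥤ E), IsChain M D → Limits.HasColimit D
  ι_mem : ∀ (J : Type w) [LinearOrder J] [WellFoundedLT J] [Nonempty J] [NoMaxOrder J],
    Ordinal.type ((· < ·) : J → J → Prop) ≤ κ → ∀ (D : J ⥤ E), IsChain M D →
      ∀ (c : Limits.Cocone D), Limits.IsColimit c → ∀ j : J, M (c.ι.app j)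
  desc_mem : ∀ (J : Type w) [LinearOrder J] [WellFoundedLT J] [Nonempty J] [NoMaxOrder J],
    Ordinal.type ((· < ·) : J → J → Prop) ≤ κ → ∀ (D : J ⥤ E), IsChain M D →
      ∀ (c : Limits.Cocone D) (hc : Limits.IsColimit c) (s : Limits.Cocone D),
        (∀ j : J, M (s.ι.app j)) → M (hc.desc s)

/-- `(E, M)` has pushouts: pushouts along maps in `M` exist and `M` is stable under pushout. -/
structure HasPushouts (M : MorphismProperty E) : Prop where
  hasPushout : ∀ {A B C : E} (f : A ⟶ C) (g : A ⟶ B), M f → Limits.HasPushout f g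
  stable : ∀ {A B C D : E} (f : A ⟶ C) (g : A ⟶ B) (i : C ⟶ D) (j : B ⟶ D),
    IsPushout f g i j → M f → M j

variable {E' : Type u₂} [Category.{v₂} E'] {E'' : Type u₃} [Category.{v₃} E'']

/-- The functor `P` preserves `κ`-compositions of `(E, M)`, i.e. the `α`-transfinite compositions
of maps in `M` for all limit ordinals `α ≤ κ`. -/
def PreservesCompositions (κ : Ordinal.{w}) (M : MorphismProperty E) (P : E ⥤ E') : Prop :=
  ∀ (J : Type w) [LinearOrder J] [WellFoundedLT J] [Nonempty J] [NoMaxOrder J],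
    Ordinal.type ((· < ·) : J → J → Prop) ≤ κ → ∀ (D : J ⥤ E), IsChain M D →
      Limits.PreservesColimit D P

/-- The functor `P` preserves transfinite compositions of maps in `M` of length exactly `κ`. -/
def PreservesTransfiniteCompositions (κ : Ordinal.{w}) (M : MorphismProperty E) (P : E ⥤ E') :
    Prop :=
  ∀ (J : Type w) [LinearOrder J] [WellFoundedLT J] [Nonempty J] [NoMaxOrder J],
    Ordinal.type ((· < ·) : J → J → Prop) = κ → ∀ (D : J ⥤ E), IsChain M D →
      Limits.PreservesColimit D P

/-- The functor `P` preserves pushouts along maps in `M`. -/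
def PreservesPushouts (M : MorphismProperty E) (P : E ⥤ E') : Prop :=
  ∀ {A B C D : E} (f : A ⟶ C) (g : A ⟶ B) (i : C ⟶ D) (j : B ⟶ D),
    M f → IsPushout f g i j → IsPushout (P.map f) (P.map g) (P.map i) (P.map j)

/-- A map `(E, M) ⟶ (E', M')` of categories with a class of maps that preserves `κ`-compositions
and pushouts. -/
structure IsExactMap (κ : Ordinal.{w}) (M : MorphismProperty E) (M' : MorphismProperty E')
    (P : E ⥤ E') : Prop where
  map_mem : ∀ {A B : E} (f : A ⟶ B), M f → M' (P.map f)
  compositions : PreservesCompositions κ M P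
  pushouts : PreservesPushouts M P

theorem IsExactMap.isChain {κ : Ordinal.{w}} {M : MorphismProperty E} {M' : MorphismProperty E'}
    {P : E ⥤ E'} (hP : IsExactMap κ M M' P) {J : Type w} [LinearOrder J] [WellFoundedLT J]
    (hJ : Ordinal.type ((· < ·) : J → J → Prop) ≤ κ) {D : J ⥤ E} (hD : IsChain M D) :
    IsChain M' (D ⋙ P) where
  continuous := by
    have := hD.continuous
    refine ⟨fun m hm => ?_⟩
    have hne : Nonempty (Set.Iio m) := by
      obtain ⟨b, hb⟩ := not_isMin_iff.1 hm.1
      exact ⟨⟨b, hb⟩⟩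
    have hmax : NoMaxOrder (Set.Iio m) := by
      refine ⟨fun a => ?_⟩
      obtain ⟨b, hb, hbm⟩ := (not_covBy_iff a.2).1 (hm.2 a.1)
      exact ⟨⟨b, hbm⟩, hb⟩
    have hch : IsChain M ((Set.principalSegIio m).monotone.functor ⋙ D) := by
      refine ⟨inferInstanceAs
        ((Set.principalSegIio m : Set.Iio m ≤i J).monotone.functor ⋙ D).IsWellOrderContinuous,
        fun a b h => ?_⟩
      have h' : a.1 ⋖ b.1 := by
        refine ⟨h.1, fun c hac hcb => ?_⟩
        exact h.2 (c := ⟨c, hcb.trans b.2⟩) hac hcb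
      exact hD.succ_mem a.1 b.1 h'
    have := hP.compositions (Set.Iio m)
      ((Ordinal.typein_lt_type LT.lt m).le.trans hJ) _ hch
    exact ⟨Limits.isColimitOfPreserves P (D.isColimitOfIsWellOrderContinuous m hm)⟩
  succ_mem a b h := hP.map_mem _ (hD.succ_mem a b h)

theorem IsExactMap.id (κ : Ordinal.{w}) (M : MorphismProperty E) : IsExactMap κ M M (𝟭 E) where
  map_mem _ h := h
  compositions _ _ _ _ _ _ _ _ := inferInstance
  pushouts _ _ _ _ _ h := h

theorem IsExactMap.comp {κ : Ordinal.{w}} {M : MorphismProperty E} {M' : MorphismProperty E'}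
    {M'' : MorphismProperty E''} {P : E ⥤ E'} {Q : E' ⥤ E''} (hP : IsExactMap κ M M' P)
    (hQ : IsExactMap κ M' M'' Q) : IsExactMap κ M M'' (P ⋙ Q) where
  map_mem f h := hQ.map_mem _ (hP.map_mem f h)
  compositions J _ _ _ _ hJ D hD := by
    have := hP.compositions J hJ D hD
    have := hQ.compositions J hJ (D ⋙ P) (hP.isChain hJ hD)
    infer_instance
  pushouts f g i j hf h := hQ.pushouts _ _ _ _ (hP.map_mem f hf) (hP.pushouts f g i j hf h)

end Classes

/-! ## Pointed endofunctors, their algebras and (algebraically) free monads -/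

/-- A pointed endofunctor. -/
structure PointedEndofunctor (E : Type u₁) [Category.{v₁} E] where
  toFunctor : E ⥤ E
  unit : 𝟭 E ⟶ toFunctor

namespace PointedEndofunctor

variable {E : Type u₁} [Category.{v₁} E]

/-- The conditions on a configuration `(E, M, F)` for the free monad sequence on a pointed
endofunctor `F` with unit `η`. The map `sq.desc _ _ _` is the Leibniz application of `η` to `f`,
i.e. the map `B ⊔_A F A ⟶ F B` induced by `η_B` and `F f`. -/
structure IsConfiguration (κ : Ordinal.{w}) (M : MorphismProperty E) (F : PointedEndofunctor E) :
    Prop where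
  compositions : HasCompositions κ M
  pushouts : HasPushouts M
  unit_mem : ∀ A : E, M (F.unit.app A)
  leibniz_mem : ∀ {A B C : E} (f : A ⟶ B) (i : B ⟶ C) (j : F.toFunctor.obj A ⟶ C)
    (sq : IsPushout f (F.unit.app A) i j), M f →
      M (sq.desc (F.unit.app B) (F.toFunctor.map f) (F.unit.naturality f))
  map_mem : ∀ {A B : E} (f : A ⟶ B), M f → M (F.toFunctor.map f)
  preserves : PreservesTransfiniteCompositions κ M F.toFunctor

/-- An algebra for a pointed endofunctor: an object `A` with a map `F A ⟶ A` that is a retraction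
of the unit. -/
structure Algebra (F : PointedEndofunctor E) where
  carrier : E
  str : F.toFunctor.obj carrier ⟶ carrier
  unit_str : F.unit.app carrier ≫ str = 𝟙 carrier

/-- A map of algebras for a pointed endofunctor. -/
@[ext]
structure Algebra.Hom {F : PointedEndofunctor E} (A B : F.Algebra) where
  hom : A.carrier ⟶ B.carrier
  comm : A.str ≫ hom = F.toFunctor.map hom ≫ B.str

instance (F : PointedEndofunctor E) : Category F.Algebra where
  Hom A B := Algebra.Hom A B
  id A := { hom := 𝟙 A.carrier, comm := by simp }
  comp f g :=
    { hom := f.hom ≫ g.hom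
      comm := by rw [← Category.assoc, f.comm, Category.assoc, g.comm, Functor.map_comp,
        Category.assoc] }
  id_comp f := Algebra.Hom.ext (Category.id_comp f.hom)
  comp_id f := Algebra.Hom.ext (Category.comp_id f.hom)
  assoc f g h := Algebra.Hom.ext (Category.assoc f.hom g.hom h.hom)

/-- A map of pointed endofunctors from `F` to (the pointed endofunctor underlying) a monad `R`. -/
structure MapToMonad (F : PointedEndofunctor E) (R : Monad E) where
  toNatTrans : F.toFunctor ⟶ R.toFunctor
  unit_comp : ∀ A : E, F.unit.app A ≫ toNatTrans.app A = R.η.app A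

/-- Restriction of monad algebras along a map from a pointed endofunctor to the monad. -/
def MapToMonad.restrict {F : PointedEndofunctor E} {R : Monad E} (σ : F.MapToMonad R) :
    R.Algebra ⥤ F.Algebra where
  obj A :=
    { carrier := A.A
      str := σ.toNatTrans.app A.A ≫ A.a
      unit_str := by rw [← Category.assoc, σ.unit_comp, A.unit] }
  map f :=
    { hom := f.f
      comm := by
        change (σ.toNatTrans.app _ ≫ _) ≫ f.f = F.toFunctor.map f.f ≫ σ.toNatTrans.app _ ≫ _
        rw [Category.assoc, ← f.h, σ.toNatTrans.naturality_assoc] }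
  map_id _ := rfl
  map_comp _ _ := rfl

end PointedEndofunctor

/-- A functor is an isomorphism of categories. -/
structure IsIsoOfCategories {A : Type u₁} [Category.{v₁} A] {B : Type u₂} [Category.{v₂} B]
    (Φ : A ⥤ B) : Prop where
  full : Φ.Full
  faithful : Φ.Faithful
  bijective : Function.Bijective Φ.obj

/-- The map `σ : F ⟶ R` exhibits `R` as the free monad on the pointed endofunctor `F`. -/
def IsFreeMonad {E : Type u₁} [Category.{v₁} E] {F : PointedEndofunctor E} {R : Monad E}
    (σ : F.MapToMonad R) : Prop :=
  ∀ (S : Monad E) (τ : F.MapToMonad S),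
    ∃! φ : R ⟶ S, ∀ A : E, σ.toNatTrans.app A ≫ φ.app A = τ.toNatTrans.app A

/-- The map `σ : F ⟶ R` exhibits `R` as the algebraically-free monad on the pointed endofunctor
`F`: restriction along `σ` is an isomorphism of categories of algebras. -/
def IsAlgebraicallyFreeMonad {E : Type u₁} [Category.{v₁} E] {F : PointedEndofunctor E}
    {R : Monad E} (σ : F.MapToMonad R) : Prop :=
  IsIsoOfCategories σ.restrict

/-! ## Pointed objects, monoids and (algebraically) free monoids -/

section Monoidal

variable {E : Type u₁} [Category.{v₁} E] [MonoidalCategory E]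

/-- The pointed endofunctor `T ⊗ (-)` of a pointed object `(T, η)`. -/
def tensorPointed (T : E) (η : 𝟙_ E ⟶ T) : PointedEndofunctor E where
  toFunctor := tensorLeft T
  unit :=
    { app := fun X => (λ_ X).inv ≫ η ▷ X
      naturality := fun X Y f => by
        change f ≫ (λ_ Y).inv ≫ η ▷ Y = ((λ_ X).inv ≫ η ▷ X) ≫ T ◁ f
        rw [leftUnitor_inv_naturality_assoc, whisker_exchange, Category.assoc] }

/-- The monad `M ⊗ (-)` of a monoid `M`. -/
def tensorMonad (M : E) [MonObj M] : Monad E where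
  toFunctor := tensorLeft M
  η := (tensorPointed M (MonObj.one (X := M))).unit
  μ :=
    { app := fun X => (α_ M M X).inv ≫ MonObj.mul (X := M) ▷ X
      naturality := fun X Y f => by
        change M ◁ M ◁ f ≫ (α_ M M Y).inv ≫ MonObj.mul ▷ Y =
          ((α_ M M X).inv ≫ MonObj.mul ▷ X) ≫ M ◁ f
        rw [Category.assoc, ← whisker_exchange]
        simp }
  assoc X := by
    have h := congrArg (fun t => t ▷ X) (MonObj.mul_assoc M)
    simp only [comp_whiskerRight] at h
    change M ◁ ((α_ M M X).inv ≫ MonObj.mul ▷ X) ≫ (α_ M M X).inv ≫ MonObj.mul ▷ X =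
      ((α_ M M (M ⊗ X)).inv ≫ MonObj.mul ▷ (M ⊗ X)) ≫ (α_ M M X).inv ≫ MonObj.mul ▷ X
    have h' : MonObj.mul ▷ (M ⊗ X) ≫ (α_ M M X).inv =
        (α_ (M ⊗ M) M X).inv ≫ (MonObj.mul (X := M) ▷ M) ▷ X := by simp
    rw [Category.assoc, reassoc_of% h', h]
    simp
  left_unit X := by
    have h := congrArg (fun t => t ▷ X) (MonObj.one_mul M)
    simp only [comp_whiskerRight] at h
    change ((λ_ (M ⊗ X)).inv ≫ MonObj.one ▷ (M ⊗ X)) ≫ (α_ M M X).inv ≫ MonObj.mul ▷ X = 𝟙 _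
    have h' : MonObj.one ▷ (M ⊗ X) ≫ (α_ M M X).inv =
        (α_ (𝟙_ E) M X).inv ≫ (MonObj.one (X := M) ▷ M) ▷ X := by simp
    rw [Category.assoc, reassoc_of% h', h]
    simp
  right_unit X := by
    have h := congrArg (fun t => t ▷ X) (MonObj.mul_one M)
    simp only [comp_whiskerRight] at h
    change M ◁ ((λ_ X).inv ≫ MonObj.one ▷ X) ≫ (α_ M M X).inv ≫ MonObj.mul ▷ X = 𝟙 _
    have h' : M ◁ (MonObj.one (X := M) ▷ X) ≫ (α_ M M X).inv =
        (α_ M (𝟙_ E) X).inv ≫ (M ◁ MonObj.one (X := M)) ▷ X := by simp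
    rw [MonoidalCategory.whiskerLeft_comp, Category.assoc, reassoc_of% h', h]
    simp

/-- The map `ι : T ⟶ M` of pointed objects exhibits the monoid `M` as the free monoid on the
pointed object `(T, η)`. -/
structure IsFreeMonoid {T : E} (η : 𝟙_ E ⟶ T) (M : E) [MonObj M] (ι : T ⟶ M) : Prop where
  pointed : η ≫ ι = MonObj.one
  existsUnique : ∀ (N : E) [MonObj N] (τ : T ⟶ N), η ≫ τ = MonObj.one →
    ∃! φ : M ⟶ N, IsMonHom φ ∧ ι ≫ φ = τ

/-- Restriction of module objects (objects with an action of the monoid `M`) along a map of pointed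
objects `ι : T ⟶ M` to algebras of the pointed endofunctor `T ⊗ (-)`. -/
def restrictModules {T : E} (η : 𝟙_ E ⟶ T) (M : E) [MonObj M] (ι : T ⟶ M)
    (hι : η ≫ ι = MonObj.one) : Mod E M ⥤ (tensorPointed T η).Algebra where
  obj A :=
    { carrier := A.X
      str := ι ▷ A.X ≫ ModObj.smul (M := M) (X := A.X)
      unit_str := by
        have h := ModObj.one_smul_self M A.X
        rw [← hι, comp_whiskerRight, Category.assoc] at h
        change ((λ_ A.X).inv ≫ η ▷ A.X) ≫ ι ▷ A.X ≫ ModObj.smul (M := M) (X := A.X) = 𝟙 A.X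
        rw [Category.assoc, h, Iso.inv_hom_id] }
  map {A B} f :=
    { hom := f.hom
      comm := by
        have h : ModObj.smul (M := M) (X := A.X) ≫ f.hom =
            M ◁ f.hom ≫ ModObj.smul (M := M) (X := B.X) := IsModHom.smul_hom
        change (ι ▷ A.X ≫ ModObj.smul (M := M) (X := A.X)) ≫ f.hom =
          T ◁ f.hom ≫ ι ▷ B.X ≫ ModObj.smul (M := M) (X := B.X)
        rw [Category.assoc, h, whisker_exchange_assoc] }
  map_id _ := rfl
  map_comp _ _ := rfl

/-- The map `ι : T ⟶ M` of pointed objects exhibits the monoid `M` as the algebraically-free monoid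
on the pointed object `(T, η)`: restriction along `ι` is an isomorphism from the category of objects
with an `M`-action to the category of algebras of the pointed endofunctor `T ⊗ (-)`. -/
def IsAlgebraicallyFreeMonoid {T : E} (η : 𝟙_ E ⟶ T) (M : E) [MonObj M] (ι : T ⟶ M) : Prop :=
  ∃ hι : η ≫ ι = MonObj.one, IsIsoOfCategories (restrictModules η M ι hι)

end Monoidal

/-! ## The category of monoidal categories and strong monoidal functors -/

/-- A monoidal category, bundled. -/
structure MonoidalCat : Type (max (u + 1) (v + 1)) where
  carrier : Type u
  [category : Category.{v} carrier]
  [monoidalCategory : MonoidalCategory carrier]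

attribute [instance] MonoidalCat.category MonoidalCat.monoidalCategory

/-- A strong monoidal functor, bundled. -/
structure MonoidalCat.Hom (C D : MonoidalCat.{v, u}) where
  functor : C.carrier ⥤ D.carrier
  [monoidal : functor.Monoidal]

attribute [instance] MonoidalCat.Hom.monoidal

/-- The identity strong monoidal functor. -/
abbrev MonoidalCat.Hom.id (C : MonoidalCat.{v, u}) : MonoidalCat.Hom C C where
  functor := 𝟭 _

/-- Composition of strong monoidal functors. -/
abbrev MonoidalCat.Hom.comp {C D E : MonoidalCat.{v, u}} (F : MonoidalCat.Hom C D)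
    (G : MonoidalCat.Hom D E) : MonoidalCat.Hom C E where
  functor := F.functor ⋙ G.functor

theorem monoidal_comp_id {C : Type u₁} [Category.{v₁} C] [MonoidalCategory C]
    {D : Type u₂} [Category.{v₂} D] [MonoidalCategory D] (F : C ⥤ D) [h : F.Monoidal] :
    (inferInstanceAs (F ⋙ 𝟭 D).Monoidal : (F ⋙ 𝟭 D).Monoidal) = (h : F.Monoidal) := by
  apply Functor.Monoidal.toLaxMonoidal_injective
  apply Functor.LaxMonoidal.ext
  · exact Category.id_comp _
  · funext X Y
    exact Category.id_comp _

theorem monoidal_id_comp {C : Type u₁} [Category.{v₁} C] [MonoidalCategory C]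
    {D : Type u₂} [Category.{v₂} D] [MonoidalCategory D] (F : C ⥤ D) [h : F.Monoidal] :
    (inferInstanceAs (𝟭 C ⋙ F).Monoidal : (𝟭 C ⋙ F).Monoidal) = (h : F.Monoidal) := by
  apply Functor.Monoidal.toLaxMonoidal_injective
  apply Functor.LaxMonoidal.ext
  · exact (congrArg _ (F.map_id _)).trans (Category.comp_id _)
  · funext X Y
    exact (congrArg _ (F.map_id _)).trans (Category.comp_id _)

theorem monoidal_assoc {C D E E' : MonoidalCat.{v, u}} (F : MonoidalCat.Hom C D)
    (G : MonoidalCat.Hom D E) (H : MonoidalCat.Hom E E') :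
    ((F.comp G).comp H).monoidal = (F.comp (G.comp H)).monoidal := by
  apply Functor.Monoidal.toLaxMonoidal_injective
  apply Functor.LaxMonoidal.ext
  · change _ ≫ _ = (_ ≫ _) ≫ _
    simp
  · funext X Y
    change _ ≫ _ = (_ ≫ _) ≫ _
    simp

theorem MonoidalCat.Hom.mk_congr {C D : MonoidalCat.{v, u}} (F : C.carrier ⥤ D.carrier)
    {m m' : F.Monoidal} (h : m = m') :
    (@MonoidalCat.Hom.mk C D F m) = (@MonoidalCat.Hom.mk C D F m') := by
  rw [h]

/-- The category of monoidal categories and strong monoidal functors. -/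
instance : Category MonoidalCat.{v, u} where
  Hom C D := MonoidalCat.Hom C D
  id C := MonoidalCat.Hom.id C
  comp F G := F.comp G
  id_comp F := MonoidalCat.Hom.mk_congr F.functor (monoidal_id_comp F.functor)
  comp_id F := MonoidalCat.Hom.mk_congr F.functor (monoidal_comp_id F.functor)
  assoc F G H := MonoidalCat.Hom.mk_congr _ (monoidal_assoc F G H)

/-! ## The category of monoidal categories with a monoid -/

/-- A strong monoidal functor `F` and an isomorphism `F M ≅ N` that is compatible with the monoid
structures of `M` and `N`. -/
structure IsMonoidIso {C D : MonoidalCat.{v, u}} (F : MonoidalCat.Hom C D) (M : C.carrier)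
    [MonObj M] (N : D.carrier) [MonObj N] (e : F.functor.obj M ≅ N) : Prop where
  one : Functor.LaxMonoidal.ε F.functor ≫ F.functor.map MonObj.one ≫ e.hom = MonObj.one
  mul : Functor.LaxMonoidal.μ F.functor M M ≫ F.functor.map MonObj.mul ≫ e.hom =
    (e.hom ⊗ₘ e.hom) ≫ MonObj.mul

theorem IsMonoidIso.id (C : MonoidalCat.{v, u}) (M : C.carrier) [MonObj M] :
    IsMonoidIso (MonoidalCat.Hom.id C) M M (Iso.refl M) where
  one := by
    change 𝟙 _ ≫ MonObj.one ≫ 𝟙 _ = _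
    simp
  mul := by
    change 𝟙 _ ≫ MonObj.mul ≫ 𝟙 _ = (𝟙 _ ⊗ₘ 𝟙 _) ≫ MonObj.mul
    simp

theorem IsMonoidIso.comp {C D E : MonoidalCat.{v, u}} {F : MonoidalCat.Hom C D}
    {G : MonoidalCat.Hom D E} {M : C.carrier} [MonObj M] {N : D.carrier} [MonObj N]
    {K : E.carrier} [MonObj K] {e : F.functor.obj M ≅ N} {e' : G.functor.obj N ≅ K}
    (h : IsMonoidIso F M N e) (h' : IsMonoidIso G N K e') :
    IsMonoidIso (F.comp G) M K (G.functor.mapIso e ≪≫ e') where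
  one := by
    rw [← h'.one, ← h.one]
    simp
  mul := by
    have h1 := h'.mul
    have h2 := congrArg G.functor.map h.mul
    simp only [Functor.map_comp] at h2
    simp only [Functor.LaxMonoidal.comp_μ, Functor.comp_map, Iso.trans_hom, Functor.mapIso_hom,
      Category.assoc]
    rw [← tensorHom_comp_tensorHom_assoc, ← h1, reassoc_of% h2,
      Functor.LaxMonoidal.μ_natural_assoc]

/-- A monoidal category with a monoid in it. -/
structure MonoidalCatWithMonoid : Type (max (u + 1) (v + 1)) where
  toMonoidalCat : MonoidalCat.{v, u}
  monoid : toMonoidalCat.carrier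
  [monObj : MonObj monoid]

attribute [instance] MonoidalCatWithMonoid.monObj

/-- A map of monoidal categories with a monoid: a strong monoidal functor together with an
isomorphism of monoids from the image of the source monoid to the target monoid. -/
structure MonoidalCatWithMonoid.Hom (C D : MonoidalCatWithMonoid.{v, u}) where
  toHom : C.toMonoidalCat ⟶ D.toMonoidalCat
  iso : toHom.functor.obj C.monoid ≅ D.monoid
  isMonoidIso : IsMonoidIso toHom C.monoid D.monoid iso

theorem MonoidalCatWithMonoid.Hom.mk_congr {C D : MonoidalCatWithMonoid.{v, u}}
    (F : C.toMonoidalCat.carrier ⥤ D.toMonoidalCat.carrier) {m m' : F.Monoidal} (h : m = m')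
    {e e' : F.obj C.monoid ≅ D.monoid} (he : e.hom = e'.hom)
    (he₁ : IsMonoidIso (@MonoidalCat.Hom.mk _ _ F m) C.monoid D.monoid e)
    (he₂ : IsMonoidIso (@MonoidalCat.Hom.mk _ _ F m') C.monoid D.monoid e') :
    MonoidalCatWithMonoid.Hom.mk (@MonoidalCat.Hom.mk _ _ F m) e he₁ =
      MonoidalCatWithMonoid.Hom.mk (@MonoidalCat.Hom.mk _ _ F m') e' he₂ := by
  subst h
  obtain rfl : e = e' := Iso.ext he
  rfl

/-- The category of monoidal categories with a monoid. -/
instance : Category MonoidalCatWithMonoid.{v, u} where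
  Hom C D := MonoidalCatWithMonoid.Hom C D
  id C := ⟨𝟙 C.toMonoidalCat, Iso.refl _, IsMonoidIso.id _ _⟩
  comp f g := ⟨f.toHom ≫ g.toHom, g.toHom.functor.mapIso f.iso ≪≫ g.iso,
    f.isMonoidIso.comp g.isMonoidIso⟩
  id_comp f := MonoidalCatWithMonoid.Hom.mk_congr f.toHom.functor
    (monoidal_id_comp f.toHom.functor)
    ((congrArg (· ≫ f.iso.hom) (f.toHom.functor.map_id _)).trans (Category.id_comp _)) _ _
  comp_id f := MonoidalCatWithMonoid.Hom.mk_congr f.toHom.functor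
    (monoidal_comp_id f.toHom.functor) (Category.comp_id _) _ _
  assoc f g h := MonoidalCatWithMonoid.Hom.mk_congr _
    (monoidal_assoc f.toHom g.toHom h.toHom)
    (by
      change h.toHom.functor.map (g.toHom.functor.map f.iso.hom ≫ g.iso.hom) ≫ h.iso.hom =
        h.toHom.functor.map (g.toHom.functor.map f.iso.hom) ≫ h.toHom.functor.map g.iso.hom ≫
          h.iso.hom
      simp) _ _

/-- The canonical projection from monoidal categories with a monoid to monoidal categories. -/
def projection : MonoidalCatWithMonoid.{v, u} ⥤ MonoidalCat.{v, u} where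
  obj C := C.toMonoidalCat
  map f := f.toHom
  map_id _ := rfl
  map_comp _ _ := rfl

/-! ## The category of configurations for the free monoid sequence on a pointed object -/

/-- A configuration `(E, M, T)` for the free monoid sequence on a pointed object. (The functors
`(-) ⊗ X` automatically extend to maps of pointed endofunctors from `T ⊗ (-)` to itself, via the
associator.) -/
structure ConfMon (κ : Ordinal.{w}) : Type (max (u + 1) (v + 1)) where
  toMonoidalCat : MonoidalCat.{v, u}
  maps : MorphismProperty toMonoidalCat.carrier
  pt : toMonoidalCat.carrier
  unit : 𝟙_ toMonoidalCat.carrier ⟶ pt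
  isConfiguration : (tensorPointed pt unit).IsConfiguration κ maps
  tensorRight_isExactMap : ∀ X : toMonoidalCat.carrier, IsExactMap κ maps maps (tensorRight X)

/-- A strong monoidal functor `F` and an isomorphism `F T ≅ T'` of pointed objects. -/
def IsPointedIso {C D : MonoidalCat.{v, u}} (F : MonoidalCat.Hom C D) {T : C.carrier}
    (η : 𝟙_ C.carrier ⟶ T) {T' : D.carrier} (η' : 𝟙_ D.carrier ⟶ T')
    (e : F.functor.obj T ≅ T') : Prop :=
  Functor.LaxMonoidal.ε F.functor ≫ F.functor.map η ≫ e.hom = η'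

theorem IsPointedIso.id (C : MonoidalCat.{v, u}) {T : C.carrier} (η : 𝟙_ C.carrier ⟶ T) :
    IsPointedIso (MonoidalCat.Hom.id C) η η (Iso.refl T) := by
  change 𝟙 _ ≫ η ≫ 𝟙 _ = _
  simp

theorem IsPointedIso.comp {C D E : MonoidalCat.{v, u}} {F : MonoidalCat.Hom C D}
    {G : MonoidalCat.Hom D E} {T : C.carrier} {η : 𝟙_ C.carrier ⟶ T} {T' : D.carrier}
    {η' : 𝟙_ D.carrier ⟶ T'} {T'' : E.carrier} {η'' : 𝟙_ E.carrier ⟶ T''}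
    {e : F.functor.obj T ≅ T'} {e' : G.functor.obj T' ≅ T''}
    (h : IsPointedIso F η η' e) (h' : IsPointedIso G η' η'' e') :
    IsPointedIso (F.comp G) η η'' (G.functor.mapIso e ≪≫ e') := by
  unfold IsPointedIso at *
  rw [← h', ← h]
  simp

/-- A map of configurations: a strong monoidal functor that maps the first class of maps to the
second one and preserves `κ`-compositions and pushouts, together with an isomorphism of pointed
objects from the image of the first pointed object to the second one. -/
structure ConfMon.Hom {κ : Ordinal.{w}} (X Y : ConfMon.{w, v, u} κ) where
  toHom : X.toMonoidalCat ⟶ Y.toMonoidalCat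
  isExactMap : IsExactMap κ X.maps Y.maps toHom.functor
  iso : toHom.functor.obj X.pt ≅ Y.pt
  isPointedIso : IsPointedIso toHom X.unit Y.unit iso

theorem ConfMon.Hom.mk_congr {κ : Ordinal.{w}} {X Y : ConfMon.{w, v, u} κ}
    (F : X.toMonoidalCat.carrier ⥤ Y.toMonoidalCat.carrier) {m m' : F.Monoidal} (h : m = m')
    {e e' : F.obj X.pt ≅ Y.pt} (he : e.hom = e'.hom) (hF : IsExactMap κ X.maps Y.maps F)
    (he₁ : IsPointedIso (@MonoidalCat.Hom.mk _ _ F m) X.unit Y.unit e)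
    (he₂ : IsPointedIso (@MonoidalCat.Hom.mk _ _ F m') X.unit Y.unit e') :
    ConfMon.Hom.mk (@MonoidalCat.Hom.mk _ _ F m) hF e he₁ =
      ConfMon.Hom.mk (@MonoidalCat.Hom.mk _ _ F m') hF e' he₂ := by
  subst h
  obtain rfl : e = e' := Iso.ext he
  rfl

/-- The category of configurations for the free monoid sequence on a pointed object. -/
instance (κ : Ordinal.{w}) : Category (ConfMon.{w, v, u} κ) where
  Hom X Y := ConfMon.Hom X Y
  id X := ⟨𝟙 X.toMonoidalCat, IsExactMap.id κ X.maps, Iso.refl _, IsPointedIso.id _ _⟩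
  comp f g := ⟨f.toHom ≫ g.toHom, f.isExactMap.comp g.isExactMap,
    g.toHom.functor.mapIso f.iso ≪≫ g.iso, f.isPointedIso.comp g.isPointedIso⟩
  id_comp f := ConfMon.Hom.mk_congr f.toHom.functor
    (monoidal_id_comp f.toHom.functor)
    ((congrArg (· ≫ f.iso.hom) (f.toHom.functor.map_id _)).trans (Category.id_comp _)) _ _ _
  comp_id f := ConfMon.Hom.mk_congr f.toHom.functor
    (monoidal_comp_id f.toHom.functor) (Category.comp_id _) _ _ _
  assoc f g h := ConfMon.Hom.mk_congr _
    (monoidal_assoc f.toHom g.toHom h.toHom)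
    (by
      change h.toHom.functor.map (g.toHom.functor.map f.iso.hom ≫ g.iso.hom) ≫ h.iso.hom =
        h.toHom.functor.map (g.toHom.functor.map f.iso.hom) ≫ h.toHom.functor.map g.iso.hom ≫
          h.iso.hom
      simp) _ _ _

/-- The canonical functor from configurations to monoidal categories. -/
def forget (κ : Ordinal.{w}) : ConfMon.{w, v, u} κ ⥤ MonoidalCat.{v, u} where
  obj X := X.toMonoidalCat
  map f := f.toHom
  map_id _ := rfl
  map_comp _ _ := rfl

/-- The data of a lift of the canonical functor `forget κ` to monoidal categories with a monoid: a
monoid in each configuration and, functorially, for each map of configurations an isomorphism of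
monoids from the image of the first monoid to the second one. -/
structure MonoidLift (κ : Ordinal.{w}) where
  monoid : ∀ X : ConfMon.{w, v, u} κ, X.toMonoidalCat.carrier
  [monObj : ∀ X : ConfMon.{w, v, u} κ, MonObj (monoid X)]
  iso : ∀ {X Y : ConfMon.{w, v, u} κ} (f : X ⟶ Y), f.toHom.functor.obj (monoid X) ≅ monoid Y
  isMonoidIso : ∀ {X Y : ConfMon.{w, v, u} κ} (f : X ⟶ Y),
    IsMonoidIso f.toHom (monoid X) (monoid Y) (iso f)
  iso_id : ∀ X : ConfMon.{w, v, u} κ, (iso (𝟙 X)).hom = 𝟙 (monoid X)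
  iso_comp : ∀ {X Y Z : ConfMon.{w, v, u} κ} (f : X ⟶ Y) (g : Y ⟶ Z),
    (iso (f ≫ g)).hom = g.toHom.functor.map (iso f).hom ≫ (iso g).hom

attribute [instance] MonoidLift.monObj

/-- The functor from configurations to monoidal categories with a monoid given by a lift. -/
def MonoidLift.toFunctor {κ : Ordinal.{w}} (Φ : MonoidLift.{w, v, u} κ) :
    ConfMon.{w, v, u} κ ⥤ MonoidalCatWithMonoid.{v, u} where
  obj X := ⟨X.toMonoidalCat, Φ.monoid X⟩
  map f := ⟨f.toHom, Φ.iso f, Φ.isMonoidIso f⟩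
  map_id X := MonoidalCatWithMonoid.Hom.mk_congr _ rfl (Φ.iso_id X) _ _
  map_comp f g := MonoidalCatWithMonoid.Hom.mk_congr _ rfl (Φ.iso_comp f g) _ _

end FreeMonoidSequence

/-! A free algebra for a pointed endofunctor `F` is built by completing partial algebras. A partial
algebra carries an operation defined only on some `dom ⟶ F obj` in `M`. One step pushes the
operation out along `dom ⟶ F obj`. It then becomes defined on all of `F obj`, but its values lie in
a larger object `B`. The new domain is `B ⊔_A F A`, and its map to `F B` is the Leibniz map, so it
is again in `M`. The transition maps are in `M` on both components, so transfinite composites up to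
length `κ` exist componentwise. Since `F` preserves composites of length `κ`, the operation of the
colimit is total (`IsStepSequence.isIso_toF`). A map from a partial algebra to an algebra extends
uniquely along each step, hence along the whole sequence (`IsStepSequence.bijective_comp`), so the
colimit is a free algebra.

The construction uses only pushouts and compositions. Any functor that preserves these and commutes
with the pointed endofunctors therefore carries the free algebra to a free algebra
(`exists_isFreeAlgebra`). Let `M` now be the free algebra of `T ⊗ (-)` on the unit. Applied to the
functors `(-) ⊗ A`, preservation says that `M ⊗ A` is the free algebra on `A`. Applied to a map of
configurations, it says that the image of `M` is free in the target.

The rest is uniqueness of extensions: it yields the multiplication of `M` and its laws, the freeness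
of `M`, the comparison isomorphisms, and their functoriality. The monad `M ⊗ (-)` has free algebras
as values, which makes it free and algebraically free.

Only colimits of chains in `M` are available, so the sequence is first formed in a cocomplete
category and then shown to remain in the original one (`exists_isIteration`). -/

namespace FreeMonoidSequence

/-! ## Transfinite iteration of a successor structure under minimal colimit assumptions -/

section Iteration

open Limits SmallObject

variable {K : Type u₁} [Category.{v₁} K] {L : Type u₂} [Category.{v₂} L]

/-- A diagram of shape a well-order is, up to isomorphism, the transfinite iteration of a successor
structure. -/
structure IsIteration (Φ : SuccStruct K) {J : Type w} [LinearOrder J] (D : J ⥤ K) : Prop where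
  bot : ∀ i : J, IsMin i → Nonempty (D.obj i ≅ Φ.X₀)
  continuous : D.IsWellOrderContinuous
  succ : ∀ (a b : J) (h : a ⋖ b), ∃ X : K,
    Nonempty (Arrow.mk (D.map (homOfLE h.le)) ≅ Φ.toSuccArrow X)

/-- A functor whose values lie in the essential image of a fully faithful functor lifts. -/
theorem exists_lift_of_essImage {y : K ⥤ L} (hy : y.FullyFaithful) {I : Type u} [Category.{v} I]
    (G : I ⥤ L) (hG : ∀ i, y.essImage (G.obj i)) : ∃ D : I ⥤ K, Nonempty (D ⋙ y ≅ G) :=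
  ⟨{ obj := fun i => (hG i).witness
     map := fun {i j} f => hy.preimage ((hG i).getIso.hom ≫ G.map f ≫ (hG j).getIso.inv)
     map_id := fun i => hy.map_injective (by simp)
     map_comp := fun f g => hy.map_injective (by simp) },
    ⟨NatIso.ofComponents (fun i => (hG i).getIso) (by intros; simp)⟩⟩

open Classical in
/-- The extension of a successor structure along a functor: objects outside the essential image are
their own successors. -/
noncomputable def extendSuccStruct (y : K ⥤ L) (Φ : SuccStruct K) : SuccStruct L where
  X₀ := y.obj Φ.X₀
  succ X := if h : y.essImage X then y.obj (Φ.succ h.witness) else X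
  toSucc X := if h : y.essImage X then
      h.getIso.inv ≫ y.map (Φ.toSucc h.witness) ≫ eqToHom (by rw [dif_pos h])
    else eqToHom (by rw [dif_neg h])

theorem extendSuccStruct_toSuccArrow (y : K ⥤ L) (Φ : SuccStruct K) (X : L)
    (h : y.essImage X) :
    Nonempty ((extendSuccStruct y Φ).toSuccArrow X ≅ Arrow.mk (y.map (Φ.toSucc h.witness))) := by
  have e : (extendSuccStruct y Φ).succ X = y.obj (Φ.succ h.witness) := dif_pos h
  refine ⟨Arrow.isoMk h.getIso.symm (eqToIso e) ?_⟩
  change h.getIso.inv ≫ y.map _ = (extendSuccStruct y Φ).toSucc X ≫ eqToHom e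
  have : (extendSuccStruct y Φ).toSucc X =
    h.getIso.inv ≫ y.map (Φ.toSucc h.witness) ≫ eqToHom e.symm := dif_pos h
  rw [this]
  simp

/-- All three conditions are reflected by a fully faithful functor: it reflects colimits and
isomorphisms between objects or between arrows. -/
theorem isIteration_of_comp {y : K ⥤ L} (hy : y.FullyFaithful) {Φ : SuccStruct K}
    {J : Type w} [LinearOrder J] (D : J ⥤ K)
    (hbot : ∀ i : J, IsMin i → Nonempty (y.obj (D.obj i) ≅ y.obj Φ.X₀))
    (hcont : (D ⋙ y).IsWellOrderContinuous)
    (hsucc : ∀ (a b : J) (h : a ⋖ b), ∃ X : K,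
      Nonempty (Arrow.mk ((D ⋙ y).map (homOfLE h.le)) ≅ Arrow.mk (y.map (Φ.toSucc X)))) :
    IsIteration Φ D where
  bot i hi := (hbot i hi).map hy.preimageIso
  continuous := by
    have := hy.full
    have := hy.faithful
    exact ⟨fun m hm => ⟨isColimitOfReflects y ((D ⋙ y).isColimitOfIsWellOrderContinuous m hm)⟩⟩
  succ a b h := by
    obtain ⟨X, ⟨e⟩⟩ := hsucc a b h
    let e₁ : y.obj (D.obj a) ≅ y.obj X := Arrow.leftFunc.mapIso e
    let e₂ : y.obj (D.obj b) ≅ y.obj (Φ.succ X) := Arrow.rightFunc.mapIso e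
    have w : e₁.hom ≫ y.map (Φ.toSucc X) = y.map (D.map (homOfLE h.le)) ≫ e₂.hom := e.hom.w
    refine ⟨X, ⟨Arrow.isoMk (hy.preimageIso e₁) (hy.preimageIso e₂) ?_⟩⟩
    have : (hy.preimageIso e₁).hom ≫ Φ.toSucc X =
        D.map (homOfLE h.le) ≫ (hy.preimageIso e₂).hom := by
      apply hy.map_injective
      simpa using w
    exact this

theorem covBy_of_initialSeg {I J : Type w} [LinearOrder I] [LinearOrder J] (f : I ≤i J) {a b : I}
    (h : a ⋖ b) : f a ⋖ f b := by
  refine ⟨f.strictMono h.1, fun c hac hcb => ?_⟩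
  obtain ⟨c, rfl⟩ := f.mem_range_of_le hcb.le
  exact h.2 (f.lt_iff_lt.1 hac) (f.lt_iff_lt.1 hcb)

/-- The iteration of a successor structure exists as soon as the iterations of limit length
less than the desired length have colimits. -/
theorem exists_isIteration (Φ : SuccStruct K) (J : Type w) [LinearOrder J] [OrderBot J]
    [SuccOrder J] [WellFoundedLT J]
    (hcolim : ∀ m : J, Order.IsSuccLimit m → ∀ D : Set.Iio m ⥤ K, IsIteration Φ D →
      HasColimit D) :
    ∃ D : J ⥤ K, IsIteration Φ D := by
  -- The opposite of the Yoneda embedding of `Kᵒᵖ`. Yoneda preserves limits, so `y` preserves the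
  -- colimits that happen to exist in `K`, and its target has all `w`-small colimits.
  let y : K ⥤ (Kᵒᵖᵒᵖ ⥤ Type (max w v₁))ᵒᵖ := (uliftYoneda.{w} (C := Kᵒᵖ)).rightOp
  have hfull : y.Full := inferInstance
  have hfaith : y.Faithful := inferInstance
  have hy : y.FullyFaithful := Functor.FullyFaithful.ofFullyFaithful y
  have hpres : ∀ (I : Type w) [LinearOrder I] (D : I ⥤ K), PreservesColimit D y := by
    intro I _ D
    have : PreservesLimitsOfSize.{w, w} (uliftYoneda.{w} (C := Kᵒᵖ)) := by
      refine preservesLimits_of_evaluation _ fun k => ?_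
      exact inferInstanceAs (PreservesLimitsOfSize (uliftCoyoneda.{w}.obj k))
    have : PreservesColimitsOfSize.{w, w} y := preservesColimitsOfSize_rightOp _
    infer_instance
  have hit : HasIterationOfShape J (Kᵒᵖᵒᵖ ⥤ Type (max w v₁))ᵒᵖ := by
    have : HasLimitsOfSize.{w, w} (Kᵒᵖᵒᵖ ⥤ Type (max w v₁)) := inferInstance
    have : HasColimitsOfSize.{w, w} (Kᵒᵖᵒᵖ ⥤ Type (max w v₁))ᵒᵖ := inferInstance
    infer_instance
  let Ψ := extendSuccStruct y Φ
  let G := Ψ.iterationFunctor J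
  -- On an initial segment where the ambient iteration has values in the essential image, it
  -- descends to an iteration in `K`. This is used below each limit element and finally on all of
  -- `J`.
  have key : ∀ {I : Type w} [LinearOrder I] (f : I ≤i J),
      (∀ i, y.essImage (G.obj (f i))) → ∃ D : I ⥤ K, IsIteration Φ D ∧
        Nonempty (D ⋙ y ≅ f.monotone.functor ⋙ G) := by
    intro I _ f hf
    obtain ⟨D, ⟨e⟩⟩ := exists_lift_of_essImage hy (f.monotone.functor ⋙ G) hf
    refine ⟨D, isIteration_of_comp hy D ?_ ?_ ?_, ⟨e⟩⟩
    · intro i hi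
      have hfi : f i = ⊥ := by
        rw [← isMin_iff_eq_bot]
        exact (InitialSeg.isMin_apply_iff f).2 hi
      exact ⟨e.app i ≪≫ eqToIso (congrArg G.obj hfi) ≪≫ Ψ.iterationFunctorObjBotIso J⟩
    · exact Functor.isWellOrderContinuous_of_iso e.symm
    · intro a b h
      have h' := covBy_of_initialSeg f h
      have hmax : ¬ IsMax (f a) := fun hm => (hm.not_lt h'.lt)
      have hb : Order.succ (f a) = f b := h'.succ_eq
      obtain ⟨e₂⟩ := extendSuccStruct_toSuccArrow y Φ (G.obj (f a)) (hf a)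
      have e₁ := (Ψ.prop_iterationFunctor_map_succ (f a) hmax).arrowIso
      have e₀ : Arrow.mk (G.map (homOfLE h'.le)) =
          Arrow.mk (G.map (homOfLE (Order.le_succ (f a)))) := by
        have : ∀ (c : J) (hc : f a ≤ c), c = f b →
            Arrow.mk (G.map (homOfLE h'.le)) = Arrow.mk (G.map (homOfLE hc)) := by
          rintro c hc rfl
          rfl
        exact this _ _ hb
      refine ⟨_, ⟨?_ ≪≫ eqToIso e₀ ≪≫ e₁ ≪≫ e₂⟩⟩
      exact Arrow.isoMk (e.app a) (e.app b) (e.hom.naturality (homOfLE h.le)).symm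
  -- At a limit element, the part already descended has a colimit by `hcolim`. Since `y` preserves
  -- it, its image is the ambient value.
  have hess : ∀ j : J, y.essImage (G.obj j) := by
    intro j
    induction j using SuccOrder.limitRecOn with
    | isMin j hj =>
      obtain rfl := hj.eq_bot
      exact ⟨_, ⟨(Ψ.iterationFunctorObjBotIso J).symm⟩⟩
    | succ j hj h =>
      obtain ⟨e₂⟩ := extendSuccStruct_toSuccArrow y Φ (G.obj j) h
      exact ⟨_, ⟨(Arrow.rightFunc.mapIso
        ((Ψ.prop_iterationFunctor_map_succ j hj).arrowIso ≪≫ e₂)).symm⟩⟩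
    | isSuccLimit j hj h =>
      obtain ⟨D, hD, ⟨e⟩⟩ := key (Set.principalSegIio j : Set.Iio j ≤i J) (fun i => h i.1 i.2)
      have := hcolim j hj D hD
      have := hpres _ D
      exact ⟨_, ⟨IsColimit.coconePointsIsoOfNatIso
        (isColimitOfPreserves y (colimit.isColimit D))
        (G.isColimitOfIsWellOrderContinuous j hj) e⟩⟩
  obtain ⟨D, hD, -⟩ := key (InitialSeg.refl _) hess
  exact ⟨D, hD⟩

end Iteration

/-! ## Partial algebras of a pointed endofunctor -/

section

open Limits SmallObject

variable {E : Type u₁} [Category.{v₁} E]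

/-- Every isomorphism is a pushout of an identity, so it lies in `M`. -/
theorem HasPushouts.respectsIso {M : MorphismProperty E} (hM : HasPushouts M)
    [M.IsMultiplicative] : M.RespectsIso := by
  have h : ∀ {A B : E} (f : A ⟶ B) [IsIso f], M f := fun f _ =>
    hM.stable (𝟙 _) (𝟙 _) f f (IsPushout.of_vert_isIso ⟨rfl⟩) (M.id_mem _)
  exact MorphismProperty.RespectsIso.mk _ (fun e f hf => M.comp_mem _ _ (h e.hom) hf)
    (fun e f hf => M.comp_mem _ _ hf (h e.hom))

namespace PointedEndofunctor

/-- A partial algebra of a pointed endofunctor `F`: an object `obj` with an object `dom` of formal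
operations on which the structure map is defined. -/
structure PartialAlgebra (F : PointedEndofunctor E) (M : MorphismProperty E) where
  obj : E
  dom : E
  incl : obj ⟶ dom
  toF : dom ⟶ F.toFunctor.obj obj
  str : dom ⟶ obj
  incl_toF : incl ≫ toF = F.unit.app obj
  incl_str : incl ≫ str = 𝟙 obj
  mem : M toF

namespace PartialAlgebra

variable {F : PointedEndofunctor E} {M : MorphismProperty E}

attribute [simp] incl_str

@[simp]
theorem incl_str_assoc (A : F.PartialAlgebra M) {Z : E} (h : A.obj ⟶ Z) :
    A.incl ≫ A.str ≫ h = h := by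
  rw [← Category.assoc, A.incl_str, Category.id_comp]

theorem incl_toF_assoc (A : F.PartialAlgebra M) {Z : E} (h : F.toFunctor.obj A.obj ⟶ Z) :
    A.incl ≫ A.toF ≫ h = F.unit.app A.obj ≫ h := by
  rw [← Category.assoc, A.incl_toF]

/-- A map of partial algebras. -/
@[ext]
structure Hom (A B : F.PartialAlgebra M) where
  obj : A.obj ⟶ B.obj
  dom : A.dom ⟶ B.dom
  incl_comm : A.incl ≫ dom = obj ≫ B.incl
  toF_comm : A.toF ≫ F.toFunctor.map obj = dom ≫ B.toF
  str_comm : A.str ≫ obj = dom ≫ B.str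

instance : Category (F.PartialAlgebra M) where
  Hom A B := Hom A B
  id A := ⟨𝟙 _, 𝟙 _, by simp, by simp, by simp⟩
  comp f g := ⟨f.obj ≫ g.obj, f.dom ≫ g.dom,
    by rw [← Category.assoc, f.incl_comm, Category.assoc, g.incl_comm, Category.assoc],
    by rw [Functor.map_comp, ← Category.assoc, f.toF_comm, Category.assoc, g.toF_comm,
      Category.assoc],
    by rw [← Category.assoc, f.str_comm, Category.assoc, g.str_comm, Category.assoc]⟩
  id_comp f := Hom.ext (Category.id_comp f.obj) (Category.id_comp f.dom)
  comp_id f := Hom.ext (Category.comp_id f.obj) (Category.comp_id f.dom)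
  assoc f g h := Hom.ext (Category.assoc f.obj g.obj h.obj) (Category.assoc f.dom g.dom h.dom)

@[ext]
theorem hom_ext {A B : F.PartialAlgebra M} {f g : A ⟶ B} (h : f.obj = g.obj)
    (h' : f.dom = g.dom) : f = g :=
  Hom.ext h h'

theorem Hom.incl_comm_assoc {A B : F.PartialAlgebra M} (f : Hom A B) {Z : E} (h : B.dom ⟶ Z) :
    A.incl ≫ f.dom ≫ h = f.obj ≫ B.incl ≫ h := by
  rw [← Category.assoc, f.incl_comm, Category.assoc]

theorem Hom.toF_comm_assoc {A B : F.PartialAlgebra M} (f : Hom A B) {Z : E}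
    (h : F.toFunctor.obj B.obj ⟶ Z) :
    A.toF ≫ F.toFunctor.map f.obj ≫ h = f.dom ≫ B.toF ≫ h := by
  rw [← Category.assoc, f.toF_comm, Category.assoc]

theorem Hom.str_comm_assoc {A B : F.PartialAlgebra M} (f : Hom A B) {Z : E} (h : B.obj ⟶ Z) :
    A.str ≫ f.obj ≫ h = f.dom ≫ B.str ≫ h := by
  rw [← Category.assoc, f.str_comm, Category.assoc]

@[simp] theorem id_obj (A : F.PartialAlgebra M) : Hom.obj (𝟙 A) = 𝟙 A.obj := rfl
@[simp] theorem comp_obj {A B C : F.PartialAlgebra M} (f : A ⟶ B) (g : B ⟶ C) :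
    (f ≫ g).obj = f.obj ≫ g.obj := rfl

variable (F M) in
/-- The underlying object of a partial algebra. -/
def objFunctor : F.PartialAlgebra M ⥤ E where
  obj A := A.obj
  map f := f.obj

variable (F M) in
/-- The domain of the structure map of a partial algebra. -/
def domFunctor : F.PartialAlgebra M ⥤ E where
  obj A := A.dom
  map f := f.dom

/-! ### Componentwise colimits of partial algebras -/

section Colimits

variable {I : Type w} [Category.{v} I] {D : I ⥤ F.PartialAlgebra M}

/-- This and the next two lemmas are the equations for a map of partial algebras after
precomposition with a coprojection `p`. They suffice because the coprojections of a colimit are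
jointly epimorphic. -/
theorem Hom.incl_extend {A B C : F.PartialAlgebra M} (p : A ⟶ B) (q : A ⟶ C)
    {f : B.obj ⟶ C.obj} {g : B.dom ⟶ C.dom} (hf : p.obj ≫ f = q.obj) (hg : p.dom ≫ g = q.dom) :
    p.obj ≫ B.incl ≫ g = p.obj ≫ f ≫ C.incl := by
  rw [← Hom.incl_comm_assoc, hg, reassoc_of% hf, Hom.incl_comm]

theorem Hom.toF_extend {A B C : F.PartialAlgebra M} (p : A ⟶ B) (q : A ⟶ C)
    {f : B.obj ⟶ C.obj} {g : B.dom ⟶ C.dom} (hf : p.obj ≫ f = q.obj) (hg : p.dom ≫ g = q.dom) :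
    p.dom ≫ B.toF ≫ F.toFunctor.map f = p.dom ≫ g ≫ C.toF := by
  rw [← Hom.toF_comm_assoc, ← Functor.map_comp, hf, reassoc_of% hg, Hom.toF_comm]

theorem Hom.str_extend {A B C : F.PartialAlgebra M} (p : A ⟶ B) (q : A ⟶ C)
    {f : B.obj ⟶ C.obj} {g : B.dom ⟶ C.dom} (hf : p.obj ≫ f = q.obj) (hg : p.dom ≫ g = q.dom) :
    p.dom ≫ B.str ≫ f = p.dom ≫ g ≫ C.str := by
  rw [← Hom.str_comm_assoc, hf, reassoc_of% hg, Hom.str_comm]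

/-- A cocone of partial algebras is a colimit if it is so on underlying objects and on domains. -/
noncomputable def isColimitOfComponents (c : Cocone D)
    (hobj : IsColimit ((objFunctor F M).mapCocone c))
    (hdom : IsColimit ((domFunctor F M).mapCocone c)) : IsColimit c :=
  have h₁ := fun (s : Cocone D) (i : I) =>
    hobj.fac ((objFunctor F M).mapCocone s) i
  have h₂ := fun (s : Cocone D) (i : I) =>
    hdom.fac ((domFunctor F M).mapCocone s) i
  { desc s :=
      { obj := hobj.desc ((objFunctor F M).mapCocone s)
        dom := hdom.desc ((domFunctor F M).mapCocone s)
        incl_comm := hobj.hom_ext fun i =>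
          Hom.incl_extend (c.ι.app i) (s.ι.app i) (h₁ s i) (h₂ s i)
        toF_comm := hdom.hom_ext fun i =>
          Hom.toF_extend (c.ι.app i) (s.ι.app i) (h₁ s i) (h₂ s i)
        str_comm := hdom.hom_ext fun i =>
          Hom.str_extend (c.ι.app i) (s.ι.app i) (h₁ s i) (h₂ s i) }
    fac s i := hom_ext (h₁ s i) (h₂ s i)
    uniq s m hm := hom_ext
      (hobj.uniq ((objFunctor F M).mapCocone s) m.obj fun i => congrArg Hom.obj (hm i))
      (hdom.uniq ((domFunctor F M).mapCocone s) m.dom fun i => congrArg Hom.dom (hm i)) }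

/-- The cocone of domains over the value of `F` at the apex of a cocone of underlying objects. -/
abbrev toFCocone (c : Cocone (D ⋙ objFunctor F M)) : Cocone (D ⋙ domFunctor F M) where
  pt := F.toFunctor.obj c.pt
  ι :=
    { app := fun i => (D.obj i).toF ≫ F.toFunctor.map (c.ι.app i)
      naturality := fun i j f => by
        have h : (D.map f).obj ≫ c.ι.app j = c.ι.app i := c.w f
        change (D.map f).dom ≫ (D.obj j).toF ≫ F.toFunctor.map (c.ι.app j) =
          ((D.obj i).toF ≫ F.toFunctor.map (c.ι.app i)) ≫ 𝟙 _
        rw [Category.comp_id, ← h, ← Hom.toF_comm_assoc]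
        exact congrArg (_ ≫ ·) (F.toFunctor.map_comp _ _).symm }

/-- The cocone of domains over the apex of a cocone of underlying objects. -/
abbrev strCocone (c : Cocone (D ⋙ objFunctor F M)) : Cocone (D ⋙ domFunctor F M) where
  pt := c.pt
  ι :=
    { app := fun i => (D.obj i).str ≫ c.ι.app i
      naturality := fun i j f => by
        have h : (D.map f).obj ≫ c.ι.app j = c.ι.app i := c.w f
        change (D.map f).dom ≫ (D.obj j).str ≫ c.ι.app j = ((D.obj i).str ≫ c.ι.app i) ≫ 𝟙 _
        rw [Category.comp_id, ← h]
        exact (Hom.str_comm_assoc _ _).symm }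

/-- The cocone of underlying objects over the apex of a cocone of domains. -/
abbrev inclCocone (c : Cocone (D ⋙ domFunctor F M)) : Cocone (D ⋙ objFunctor F M) where
  pt := c.pt
  ι :=
    { app := fun i => (D.obj i).incl ≫ c.ι.app i
      naturality := fun i j f => by
        have h : (D.map f).dom ≫ c.ι.app j = c.ι.app i := c.w f
        change (D.map f).obj ≫ (D.obj j).incl ≫ c.ι.app j = ((D.obj i).incl ≫ c.ι.app i) ≫ 𝟙 _
        rw [Category.comp_id, ← h]
        exact (Hom.incl_comm_assoc _ _).symm }

/-- The cocone of partial algebras over colimits of underlying objects and of domains. -/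
noncomputable def componentsCocone {c : Cocone (D ⋙ objFunctor F M)} (hc : IsColimit c)
    {c' : Cocone (D ⋙ domFunctor F M)} (hc' : IsColimit c') (h : M (hc'.desc (toFCocone c))) :
    Cocone D :=
  have h₁ (i : I) : c.ι.app i ≫ hc.desc (inclCocone c') = (D.obj i).incl ≫ c'.ι.app i :=
    hc.fac _ i
  have h₂ (i : I) : c'.ι.app i ≫ hc'.desc (toFCocone c) =
    (D.obj i).toF ≫ F.toFunctor.map (c.ι.app i) := hc'.fac _ i
  have h₃ (i : I) : c'.ι.app i ≫ hc'.desc (strCocone c) = (D.obj i).str ≫ c.ι.app i :=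
    hc'.fac _ i
  { pt :=
      { obj := c.pt
        dom := c'.pt
        incl := hc.desc (inclCocone c')
        toF := hc'.desc (toFCocone c)
        str := hc'.desc (strCocone c)
        incl_toF := hc.hom_ext fun i => by
          have := F.unit.naturality (c.ι.app i)
          rw [reassoc_of% (h₁ i)]
          refine (Category.assoc _ _ _).trans <| (congrArg ((D.obj i).incl ≫ ·) (h₂ i)).trans ?_
          refine Eq.trans ?_ this.symm
          exact incl_toF_assoc _ _
        incl_str := hc.hom_ext fun i => by
          rw [reassoc_of% (h₁ i)]
          refine (Category.assoc _ _ _).trans <| (congrArg ((D.obj i).incl ≫ ·) (h₃ i)).trans ?_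
          refine Eq.trans ?_ (Category.comp_id _).symm
          exact incl_str_assoc _ _
        mem := h }
    ι :=
      { app := fun i =>
          { obj := c.ι.app i
            dom := c'.ι.app i
            incl_comm := (h₁ i).symm
            toF_comm := (h₂ i).symm
            str_comm := (h₃ i).symm }
        naturality := fun i j f => hom_ext (c.ι.naturality f) (c'.ι.naturality f) } }

/-- The componentwise colimit of partial algebras. -/
noncomputable def isColimitComponentsCocone {c : Cocone (D ⋙ objFunctor F M)} (hc : IsColimit c)
    {c' : Cocone (D ⋙ domFunctor F M)} (hc' : IsColimit c') (h : M (hc'.desc (toFCocone c))) :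
    IsColimit (componentsCocone hc hc' h) :=
  isColimitOfComponents _ (hc.ofIsoColimit (Cocone.ext (Iso.refl _) fun _ => Category.comp_id _))
    (hc'.ofIsoColimit (Cocone.ext (Iso.refl _) fun _ => Category.comp_id _))

/-- The componentwise cocone is a colimit, hence isomorphic to any other colimit cocone. Its only
existence condition is that the induced map from the colimit of domains is in `M`. -/
theorem nonempty_isColimit_components {c : Cocone (D ⋙ objFunctor F M)} (hc : IsColimit c)
    {c' : Cocone (D ⋙ domFunctor F M)} (hc' : IsColimit c') (h : M (hc'.desc (toFCocone c)))
    {s : Cocone D} (hs : IsColimit s) :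
    Nonempty (IsColimit ((objFunctor F M).mapCocone s)) ∧
      Nonempty (IsColimit ((domFunctor F M).mapCocone s)) := by
  let e := (isColimitComponentsCocone hc hc' h).uniqueUpToIso hs
  let i : c ≅ (objFunctor F M).mapCocone (componentsCocone hc hc' h) :=
    Cocone.ext (Iso.refl _) (fun _ => Category.comp_id _)
  let i' : c' ≅ (domFunctor F M).mapCocone (componentsCocone hc hc' h) :=
    Cocone.ext (Iso.refl _) (fun _ => Category.comp_id _)
  exact ⟨⟨hc.ofIsoColimit (i ≪≫ (Cocone.functoriality D (objFunctor F M)).mapIso e)⟩,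
    ⟨hc'.ofIsoColimit (i' ≪≫ (Cocone.functoriality D (domFunctor F M)).mapIso e)⟩⟩

end Colimits

end PartialAlgebra

end PointedEndofunctor

end

section

open Limits SmallObject

variable {E : Type u₁} [Category.{v₁} E]

namespace PointedEndofunctor

namespace PartialAlgebra

variable {F : PointedEndofunctor E} {M : MorphismProperty E}

/-! ### One step of the free algebra sequence -/

/-- A map of partial algebras `A ⟶ B` that freely adjoins to `A` the values of the structure map on
all of `F A`. -/
def IsStep {A B : F.PartialAlgebra M} (f : A ⟶ B) : Prop :=
  -- Here `y` places `F A` in the new domain, and `y ≫ B.str` is the operation, now total on `F A`.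
  -- Stating the step through pushout squares makes it invariant under isomorphism and under
  -- functors preserving these pushouts.
  ∃ y : F.toFunctor.obj A.obj ⟶ B.dom,
    IsPushout A.toF A.str (y ≫ B.str) f.obj ∧ IsPushout f.obj (F.unit.app A.obj) B.incl y ∧
      A.toF ≫ y = f.dom ∧ y ≫ B.toF = F.toFunctor.map f.obj

/-- `f.obj` is a pushout of `A.toF`, and `f.dom` is `A.toF` followed by a pushout of `f.obj`. -/
theorem IsStep.mem [M.IsMultiplicative] (hM : HasPushouts M) {A B : F.PartialAlgebra M}
    {f : A ⟶ B} (hf : IsStep f) : M f.obj ∧ M f.dom := by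
  obtain ⟨y, h₁, h₂, h₃, -⟩ := hf
  have h := hM.stable _ _ _ _ h₁ A.mem
  refine ⟨h, ?_⟩
  rw [← h₃]
  exact M.comp_mem _ _ A.mem (hM.stable _ _ _ _ h₂ h)

/-- Take for `B.obj` the pushout of `A.toF` and `A.str`, and for `B.dom` the pushout of `A.obj ⟶
B.obj` along the unit at `A.obj`. Then `B.toF` is the Leibniz map of `A.obj ⟶ B.obj`, so it is in
`M` by the Leibniz condition. -/
theorem exists_isStep {κ : Ordinal.{w}} (hF : F.IsConfiguration κ M) (A : F.PartialAlgebra M) :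
    ∃ (B : F.PartialAlgebra M) (f : A ⟶ B), IsStep f := by
  have := hF.pushouts.hasPushout A.toF A.str A.mem
  have sq := IsPushout.of_hasPushout A.toF A.str
  set x := pushout.inl A.toF A.str
  set z := pushout.inr A.toF A.str
  have hz : M z := hF.pushouts.stable _ _ _ _ sq A.mem
  have := hF.pushouts.hasPushout z (F.unit.app A.obj) hz
  have sq' := IsPushout.of_hasPushout z (F.unit.app A.obj)
  set i := pushout.inl z (F.unit.app A.obj)
  set y := pushout.inr z (F.unit.app A.obj)
  have hx : F.unit.app A.obj ≫ x = z := by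
    rw [← A.incl_toF, Category.assoc, sq.w, A.incl_str_assoc]
  let B : F.PartialAlgebra M :=
    { obj := _
      dom := _
      incl := i
      toF := sq'.desc (F.unit.app _) (F.toFunctor.map z) (F.unit.naturality z)
      str := sq'.desc (𝟙 _) x (by rw [hx, Category.comp_id])
      incl_toF := sq'.inl_desc _ _ _
      incl_str := sq'.inl_desc _ _ _
      mem := hF.leibniz_mem z i y sq' hz }
  have hstr : y ≫ B.str = x := sq'.inr_desc _ _ _
  have htoF : y ≫ B.toF = F.toFunctor.map z := sq'.inr_desc _ _ _
  let f : A ⟶ B :=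
    { obj := z
      dom := A.toF ≫ y
      incl_comm := by rw [A.incl_toF_assoc, sq'.w]
      toF_comm := by rw [Category.assoc, htoF]
      str_comm := by rw [Category.assoc, hstr, sq.w] }
  exact ⟨B, f, y, by rwa [hstr], sq', rfl, htoF⟩

/-- Needed because the successor maps of an iteration are known only up to isomorphism of arrows. -/
theorem IsStep.of_arrow_iso {A B A' B' : F.PartialAlgebra M} {f : A ⟶ B} {g : A' ⟶ B'}
    (hg : IsStep g) (e : Arrow.mk f ≅ Arrow.mk g) : IsStep f := by
  obtain ⟨y, h₁, h₂, h₃, h₄⟩ := hg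
  obtain ⟨a, b, w⟩ : ∃ (a : A ≅ A') (b : B ≅ B'), a.hom ≫ g = f ≫ b.hom :=
    ⟨Arrow.leftFunc.mapIso e, Arrow.rightFunc.mapIso e, e.hom.w⟩
  have w₁ : a.hom.obj ≫ g.obj = f.obj ≫ b.hom.obj := congrArg Hom.obj w
  have w₂ : a.hom.dom ≫ g.dom = f.dom ≫ b.hom.dom := congrArg Hom.dom w
  let ao : A.obj ≅ A'.obj := (objFunctor F M).mapIso a
  let bo : B.obj ≅ B'.obj := (objFunctor F M).mapIso b
  let ad : A.dom ≅ A'.dom := (domFunctor F M).mapIso a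
  let bd : B.dom ≅ B'.dom := (domFunctor F M).mapIso b
  have hao : ao.hom = a.hom.obj := rfl
  have hbo : bo.hom = b.hom.obj := rfl
  have had : ad.hom = a.hom.dom := rfl
  have hbd : bd.hom = b.hom.dom := rfl
  have ha₁ : A.toF ≫ F.toFunctor.map ao.hom = ad.hom ≫ A'.toF := a.hom.toF_comm
  have ha₂ : A.str ≫ ao.hom = ad.hom ≫ A'.str := a.hom.str_comm
  have hb₁ : B.toF ≫ F.toFunctor.map bo.hom = bd.hom ≫ B'.toF := b.hom.toF_comm
  have hb₂ : B.str ≫ bo.hom = bd.hom ≫ B'.str := b.hom.str_comm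
  have hb₃ : B.incl ≫ bd.hom = bo.hom ≫ B'.incl := b.hom.incl_comm
  rw [← hao, ← hbo] at w₁
  rw [← had, ← hbd] at w₂
  refine ⟨F.toFunctor.map ao.hom ≫ y ≫ bd.inv, ?_, ?_, ?_, ?_⟩
  · refine IsPushout.of_iso h₁ ad.symm (F.toFunctor.mapIso ao).symm ao.symm bo.symm ?_ ?_ ?_ ?_
    · simp [Iso.eq_inv_comp, ← reassoc_of% ha₁, ← Functor.map_comp]
    · simp [Iso.eq_inv_comp, ← reassoc_of% ha₂]
    · have : bd.inv ≫ B.str = B'.str ≫ bo.inv := by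
        rw [Iso.inv_comp_eq, ← reassoc_of% hb₂, Iso.hom_inv_id, Category.comp_id]
      simp [← Functor.map_comp_assoc, this]
    · simp [Iso.comp_inv_eq, ← w₁]
  · refine IsPushout.of_iso h₂ ao.symm bo.symm (F.toFunctor.mapIso ao).symm bd.symm ?_ ?_ ?_ ?_
    · simp [Iso.comp_inv_eq, ← w₁]
    · simpa using (F.unit.naturality ao.inv).symm
    · simp [Iso.comp_inv_eq, hb₃]
    · simp [← Functor.map_comp_assoc]
  · rw [reassoc_of% ha₁, reassoc_of% h₃, reassoc_of% w₂, bd.hom_inv_id, Category.comp_id]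
  · have : bd.inv ≫ B.toF = B'.toF ≫ F.toFunctor.map bo.inv := by
      rw [Iso.inv_comp_eq, ← reassoc_of% hb₁, ← Functor.map_comp]
      simp
    rw [Category.assoc, Category.assoc, this, reassoc_of% h₄, ← Functor.map_comp,
      ← Functor.map_comp, reassoc_of% w₁, bo.hom_inv_id, Category.comp_id]

/-! ### Algebras as total partial algebras -/

variable (M) in
/-- An algebra, as a partial algebra with everywhere defined structure map. -/
abbrev ofAlgebra [M.ContainsIdentities] (A : F.Algebra) : F.PartialAlgebra M where
  obj := A.carrier
  dom := F.toFunctor.obj A.carrier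
  incl := F.unit.app A.carrier
  toF := 𝟙 _
  str := A.str
  incl_toF := Category.comp_id _
  incl_str := A.unit_str
  mem := M.id_mem _

section

variable [M.ContainsIdentities]

theorem dom_eq_of_hom_ofAlgebra {B : F.PartialAlgebra M} {A : F.Algebra}
    (g : B ⟶ ofAlgebra M A) : g.dom = B.toF ≫ F.toFunctor.map g.obj :=
  (g.toF_comm.trans (Category.comp_id _)).symm

theorem str_eq_of_hom_ofAlgebra {B : F.PartialAlgebra M} {A : F.Algebra}
    (g : B ⟶ ofAlgebra M A) :
    B.str ≫ g.obj = B.toF ≫ F.toFunctor.map g.obj ≫ A.str := by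
  have h := g.str_comm
  rw [dom_eq_of_hom_ofAlgebra, Category.assoc] at h
  exact h

theorem hom_ofAlgebra_ext {B : F.PartialAlgebra M} {A : F.Algebra} {g g' : B ⟶ ofAlgebra M A}
    (h : g.obj = g'.obj) : g = g' :=
  hom_ext h (by rw [dom_eq_of_hom_ofAlgebra, dom_eq_of_hom_ofAlgebra, h])

/-- A map from a partial algebra to an algebra. -/
abbrev homOfAlgebra {B : F.PartialAlgebra M} {A : F.Algebra} (g : B.obj ⟶ A.carrier)
    (h : B.str ≫ g = B.toF ≫ F.toFunctor.map g ≫ A.str) : B ⟶ ofAlgebra M A where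
  obj := g
  dom := B.toF ≫ F.toFunctor.map g
  incl_comm := by
    rw [incl_toF_assoc]
    exact (F.unit.naturality g).symm
  toF_comm := (Category.comp_id _).symm
  str_comm := h.trans (Category.assoc _ _ _).symm

/-- A map `h` from `A` to an algebra `C` forces the value `F h ≫ C.str` on `F A`. It agrees with `h`
on `A.dom`, so the first pushout gives exactly one extension to `B.obj`. The second pushout shows
that this extension respects the operation of `B`. The component on domains is determined because
`C` is total. -/
theorem IsStep.bijective_comp {A B : F.PartialAlgebra M} {f : A ⟶ B} (hf : IsStep f)
    (C : F.Algebra) : Function.Bijective (fun g : B ⟶ ofAlgebra M C => f ≫ g) := by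
  obtain ⟨y, h₁, h₂, -, h₄⟩ := hf
  have key (g : B ⟶ ofAlgebra M C) : (y ≫ B.str) ≫ g.obj =
      F.toFunctor.map (f ≫ g).obj ≫ C.str := by
    rw [Category.assoc, str_eq_of_hom_ofAlgebra, reassoc_of% h₄]
    exact (Functor.map_comp_assoc _ _ _ _).symm
  constructor
  · intro g g' h
    apply hom_ofAlgebra_ext
    apply h₁.hom_ext
    · refine (key g).trans (Eq.trans ?_ (key g').symm)
      dsimp only at h
      rw [h]
    · exact congrArg Hom.obj h
  · intro h
    obtain ⟨g, hg₁, hg₂⟩ : ∃ g : B.obj ⟶ C.carrier,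
        (y ≫ B.str) ≫ g = F.toFunctor.map h.obj ≫ C.str ∧
          f.obj ≫ g = h.obj := by
      have := str_eq_of_hom_ofAlgebra h
      exact ⟨h₁.desc _ _ this.symm, h₁.inl_desc _ _ _, h₁.inr_desc _ _ _⟩
    refine ⟨homOfAlgebra g ?_, hom_ofAlgebra_ext hg₂⟩
    apply h₂.hom_ext
    · have := F.unit.naturality g
      dsimp at this
      rw [incl_str_assoc, incl_toF_assoc, ← reassoc_of% this, C.unit_str, Category.comp_id]
    · rw [← Category.assoc, hg₁, reassoc_of% h₄, ← hg₂, Functor.map_comp_assoc]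

/-- The algebra underlying a partial algebra with everywhere defined structure map. -/
noncomputable abbrev toAlgebra (B : F.PartialAlgebra M) [IsIso B.toF] : F.Algebra where
  carrier := B.obj
  str := inv B.toF ≫ B.str
  unit_str := by rw [← incl_toF_assoc, IsIso.hom_inv_id_assoc, incl_str]

end

end PartialAlgebra

end PointedEndofunctor

end

section

open Limits SmallObject

variable {E : Type u₁} [Category.{v₁} E]

theorem nonempty_Iio_of_isSuccLimit {J : Type w} [LinearOrder J] {m : J}
    (hm : Order.IsSuccLimit m) : Nonempty (Set.Iio m) := by
  obtain ⟨b, hb⟩ := not_isMin_iff.1 hm.1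
  exact ⟨⟨b, hb⟩⟩

theorem noMaxOrder_Iio_of_isSuccLimit {J : Type w} [LinearOrder J] {m : J}
    (hm : Order.IsSuccLimit m) : NoMaxOrder (Set.Iio m) := by
  refine ⟨fun a => ?_⟩
  obtain ⟨b, hb, hbm⟩ := (not_covBy_iff a.2).1 (hm.2 a.1)
  exact ⟨⟨b, hbm⟩, hb⟩

theorem IsIteration.restrict_Iio {Φ : SuccStruct E} {J : Type w} [LinearOrder J] {D : J ⥤ E}
    (hD : IsIteration Φ D) (m : J) :
    IsIteration Φ ((Set.principalSegIio m).monotone.functor ⋙ D) where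
  bot i hi := hD.bot i.1 ((InitialSeg.isMin_apply_iff
    (Set.principalSegIio m : Set.Iio m ≤i J)).2 hi)
  continuous := by
    have := hD.continuous
    exact inferInstanceAs
      ((Set.principalSegIio m : Set.Iio m ≤i J).monotone.functor ⋙ D).IsWellOrderContinuous
  succ a b h := hD.succ a.1 b.1
    (covBy_of_initialSeg (Set.principalSegIio m : Set.Iio m ≤i J) h)

namespace PointedEndofunctor

namespace PartialAlgebra

variable {F : PointedEndofunctor E} {M : MorphismProperty E}

/-! ### Chains of partial algebras -/

/-- A diagram of partial algebras, of shape a well-order, that is cocontinuous on components and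
whose successor maps are steps. -/
structure IsStepSequence {J : Type w} [LinearOrder J] (D : J ⥤ F.PartialAlgebra M) : Prop where
  obj_chain : IsChain M (D ⋙ objFunctor F M)
  dom_chain : IsChain M (D ⋙ domFunctor F M)
  step : ∀ (a b : J) (h : a ⋖ b), IsStep (D.map (homOfLE h.le))

section

variable {κ : Ordinal.{w}} (hF : F.IsConfiguration κ M) {J : Type w} [LinearOrder J]
  [WellFoundedLT J] [Nonempty J] [NoMaxOrder J]
  (hJ : Ordinal.type ((· < ·) : J → J → Prop) ≤ κ) {D : J ⥤ F.PartialAlgebra M}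
  (hobj : IsChain M (D ⋙ objFunctor F M)) (hdom : IsChain M (D ⋙ domFunctor F M))

include hF hJ hobj hdom

/-- The components `toF ≫ F(coprojection)` are in `M`, and maps induced by cocones in `M` are in
`M`. Thus `F` need not preserve colimits of chains shorter than `κ`. -/
theorem mem_desc_toFCocone {c : Cocone (D ⋙ objFunctor F M)} (hc : IsColimit c)
    {c' : Cocone (D ⋙ domFunctor F M)} (hc' : IsColimit c') : M (hc'.desc (toFCocone c)) := by
  have := hF.compositions.isMultiplicative
  exact hF.compositions.desc_mem J hJ _ hdom c' hc' _ fun j => M.comp_mem _ _ (D.obj j).mem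
    (hF.map_mem _ (hF.compositions.ι_mem J hJ _ hobj c hc j))

theorem hasColimit_of_isChain : HasColimit D := by
  have := hF.compositions.hasColimit J hJ _ hobj
  have := hF.compositions.hasColimit J hJ _ hdom
  exact ⟨⟨_, isColimitComponentsCocone (colimit.isColimit _) (colimit.isColimit _)
    (mem_desc_toFCocone hF hJ hobj hdom (colimit.isColimit _) (colimit.isColimit _))⟩⟩

theorem nonempty_isColimit_components_of_isChain {s : Cocone D} (hs : IsColimit s) :
    Nonempty (IsColimit ((objFunctor F M).mapCocone s)) ∧
      Nonempty (IsColimit ((domFunctor F M).mapCocone s)) := by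
  have := hF.compositions.hasColimit J hJ _ hobj
  have := hF.compositions.hasColimit J hJ _ hdom
  exact nonempty_isColimit_components (colimit.isColimit _) (colimit.isColimit _)
    (mem_desc_toFCocone hF hJ hobj hdom (colimit.isColimit _) (colimit.isColimit _)) hs

end

/-- An iteration of steps is componentwise cocontinuous. -/
theorem isStepSequence_of_isIteration {κ : Ordinal.{w}} (hF : F.IsConfiguration κ M)
    {Φ : SuccStruct (F.PartialAlgebra M)} (hΦ : ∀ A, IsStep (Φ.toSucc A)) (o : Ordinal.{w})
    (ho : o ≤ κ) : ∀ (J : Type w) [LinearOrder J] [WellFoundedLT J]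
      (_ : Ordinal.type ((· < ·) : J → J → Prop) = o) (D : J ⥤ F.PartialAlgebra M)
      (_ : IsIteration Φ D), IsStepSequence D := by
  have := hF.compositions.isMultiplicative
  -- Continuity at a limit element is known for partial algebras. To pass to components, the part
  -- below must already be a chain on components, which is the claim for a smaller order type.
  induction o using WellFoundedLT.induction with
  | ind o ih =>
  intro J _ _ hJ D hD
  have hstep (a b : J) (h : a ⋖ b) : IsStep (D.map (homOfLE h.le)) := by
    obtain ⟨X, ⟨e⟩⟩ := hD.succ a b h
    exact (hΦ X).of_arrow_iso e
  have hcont (m : J) (hm : Order.IsSuccLimit m) :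
      Nonempty (IsColimit ((objFunctor F M).mapCocone ((Set.principalSegIio m).cocone D))) ∧
      Nonempty (IsColimit ((domFunctor F M).mapCocone ((Set.principalSegIio m).cocone D))) := by
    have := nonempty_Iio_of_isSuccLimit hm
    have := noMaxOrder_Iio_of_isSuccLimit hm
    have hlt : Ordinal.type ((· < ·) : Set.Iio m → Set.Iio m → Prop) < o :=
      hJ ▸ Ordinal.typein_lt_type LT.lt m
    have h := ih _ hlt (hlt.le.trans ho) (Set.Iio m) rfl _ (hD.restrict_Iio m)
    have := hD.continuous
    exact nonempty_isColimit_components_of_isChain hF (hlt.le.trans ho) h.obj_chain h.dom_chain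
      (D.isColimitOfIsWellOrderContinuous m hm)
  refine ⟨⟨⟨fun m hm => ?_⟩, fun a b h => ((hstep a b h).mem hF.pushouts).1⟩,
    ⟨⟨fun m hm => ?_⟩, fun a b h => ((hstep a b h).mem hF.pushouts).2⟩, hstep⟩
  · exact (hcont m hm).1.map fun h => h.ofIsoColimit (Cocone.ext (Iso.refl _)
      fun _ => Category.comp_id _)
  · exact (hcont m hm).2.map fun h => h.ofIsoColimit (Cocone.ext (Iso.refl _)
      fun _ => Category.comp_id _)

/-- The discrete partial algebra on an object. -/
abbrev discrete (X : E) (h : M (F.unit.app X)) : F.PartialAlgebra M where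
  obj := X
  dom := X
  incl := 𝟙 X
  toF := F.unit.app X
  str := 𝟙 X
  incl_toF := Category.id_comp _
  incl_str := Category.id_comp _
  mem := h

/-- The free algebra sequence exists. -/
theorem exists_isStepSequence {κ : Ordinal.{w}} (hF : F.IsConfiguration κ M) (X : E)
    (J : Type w) [LinearOrder J] [OrderBot J] [SuccOrder J] [WellFoundedLT J]
    (hJ : Ordinal.type ((· < ·) : J → J → Prop) ≤ κ) :
    ∃ D : J ⥤ F.PartialAlgebra M, IsStepSequence D ∧
      Nonempty (D.obj ⊥ ≅ discrete X (hF.unit_mem X)) := by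
  choose s t ht using exists_isStep hF
  let Φ : SuccStruct (F.PartialAlgebra M) := ⟨discrete X (hF.unit_mem X), s, t⟩
  -- The colimits required at limit elements exist because an iteration of steps is a chain in `M`
  -- on both components.
  obtain ⟨D, hD⟩ := exists_isIteration Φ J fun m hm D hD => by
    have := nonempty_Iio_of_isSuccLimit hm
    have := noMaxOrder_Iio_of_isSuccLimit hm
    have hlt := ((Ordinal.typein_lt_type LT.lt m).le.trans hJ)
    have h := isStepSequence_of_isIteration hF (Φ := Φ) ht _ hlt (Set.Iio m) rfl D hD
    exact hasColimit_of_isChain (J := Set.Iio m) hF hlt h.obj_chain h.dom_chain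
  exact ⟨D, isStepSequence_of_isIteration hF (Φ := Φ) ht _ hJ J rfl D hD, hD.bot ⊥ isMin_bot⟩

/-- The inclusion of the first stage of a step sequence in its colimit is orthogonal to
algebras. -/
theorem IsStepSequence.bijective_comp [M.ContainsIdentities] {J : Type w} [LinearOrder J]
    [OrderBot J] [SuccOrder J] [WellFoundedLT J] {D : J ⥤ F.PartialAlgebra M}
    (hD : IsStepSequence D) {c : Cocone D} (hobj : IsColimit ((objFunctor F M).mapCocone c))
    (hdom : IsColimit ((domFunctor F M).mapCocone c)) (A : F.Algebra) :
    Function.Bijective (fun g : c.pt ⟶ ofAlgebra M A => c.ι.app ⊥ ≫ g) := by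
  have hcont : D.IsWellOrderContinuous := ⟨fun m hm => by
    have h₁ := hD.obj_chain.continuous
    have h₂ := hD.dom_chain.continuous
    exact ⟨isColimitOfComponents _
      (((D ⋙ objFunctor F M).isColimitOfIsWellOrderContinuous m hm).ofIsoColimit
        (Cocone.ext (Iso.refl _) fun _ => Category.comp_id _))
      (((D ⋙ domFunctor F M).isColimitOfIsWellOrderContinuous m hm).ofIsoColimit
        (Cocone.ext (Iso.refl _) fun _ => Category.comp_id _))⟩⟩
  -- Maps into a fixed algebra form a colimit-preserving functor to the opposite of types. It
  -- inverts every step, and isomorphisms are closed under transfinite composition.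
  let G : F.PartialAlgebra M ⥤ (Type v₁)ᵒᵖ := (yoneda.obj (ofAlgebra M A)).rightOp
  have hG : ∀ {X Y : F.PartialAlgebra M} (f : X ⟶ Y),
      (MorphismProperty.isomorphisms _).inverseImage G f ↔
        Function.Bijective (fun g : Y ⟶ ofAlgebra M A => f ≫ g) := by
    intro X Y f
    change IsIso ((yoneda.obj (ofAlgebra M A)).map f.op).op ↔ _
    rw [isIso_op_iff, isIso_iff_bijective]
    rfl
  have : PreservesColimitsOfSize.{w, w} G := preservesColimitsOfSize_rightOp _
  have : PreservesWellOrderContinuousOfShape J G := ⟨fun j hj => inferInstance⟩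
  let t : ((MorphismProperty.isomorphisms _).inverseImage G).TransfiniteCompositionOfShape J
      (c.ι.app ⊥) :=
    { F := D
      isoBot := Iso.refl _
      incl := c.ι
      isColimit := isColimitOfComponents c hobj hdom
      fac := Category.id_comp _
      map_mem := fun j hj => (hG _).2
        ((hD.step _ _ (Order.covBy_succ_of_not_isMax hj)).bijective_comp A) }
  exact (hG _).1 t.map.isIso

/-- The structure map of the colimit of a step sequence of length `κ` is everywhere defined. -/
theorem IsStepSequence.isIso_toF {κ : Ordinal.{w}} (hF : F.IsConfiguration κ M)
    {J : Type w} [LinearOrder J] [WellFoundedLT J] [Nonempty J] [NoMaxOrder J]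
    (hJ : Ordinal.type ((· < ·) : J → J → Prop) = κ) {D : J ⥤ F.PartialAlgebra M}
    (hD : IsStepSequence D) {c : Cocone D} (hobj : IsColimit ((objFunctor F M).mapCocone c))
    (hdom : IsColimit ((domFunctor F M).mapCocone c)) : IsIso c.pt.toF := by
  let _ : SuccOrder J := SuccOrder.ofLinearWellFoundedLT J
  have := hF.preserves J hJ _ hD.obj_chain
  let hc := isColimitOfPreserves F.toFunctor hobj
  let ι (j : J) : D.obj j ⟶ c.pt := c.ι.app j
  have hw {i j : J} (h : i ≤ j) : D.map (homOfLE h) ≫ ι j = ι i := c.w _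
  have hwd {i j : J} (h : i ≤ j) : (D.map (homOfLE h)).dom ≫ (ι j).dom =
    (ι i).dom := congrArg Hom.dom (hw h)
  have hwo {i j : J} (h : i ≤ j) : (D.map (homOfLE h)).obj ≫ (ι j).obj =
    (ι i).obj := congrArg Hom.obj (hw h)
  choose y hy using fun j : J => hD.step _ _ (Order.covBy_succ j)
  have hy₁ (j : J) : (D.obj j).toF ≫ y j = (D.map (homOfLE (Order.le_succ j))).dom := (hy j).2.2.1
  have hy₂ (j : J) : y j ≫ (D.obj (Order.succ j)).toF =
    F.toFunctor.map (D.map (homOfLE (Order.le_succ j))).obj := (hy j).2.2.2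
  -- The inverse of `toF`: at stage `j`, the map `y j` sends `F` of that stage into the domain of
  -- the next one. It is defined on `F c.pt.obj` because `F` preserves this colimit of length
  -- exactly `κ`.
  let s : Cocone ((D ⋙ objFunctor F M) ⋙ F.toFunctor) :=
    { pt := c.pt.dom
      ι :=
        { app := fun j => y j ≫ (ι (Order.succ j)).dom
          naturality := fun i j f => by
            obtain ⟨hij, rfl⟩ : ∃ h : i ≤ j, f = homOfLE h := ⟨leOfHom f, rfl⟩
            change F.toFunctor.map (D.map (homOfLE hij)).obj ≫ y j ≫
              (ι (Order.succ j)).dom = (y i ≫ (ι (Order.succ i)).dom) ≫ 𝟙 _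
            rw [Category.comp_id]
            obtain rfl | h := hij.eq_or_lt
            · have : D.map (homOfLE hij) = 𝟙 _ := D.map_id _
              rw [this, id_obj, CategoryTheory.Functor.map_id, Category.id_comp]
            · have h' : Order.succ i ≤ j := Order.succ_le_of_lt h
              have e : D.map (homOfLE hij) =
                D.map (homOfLE (Order.le_succ i)) ≫ D.map (homOfLE h') := by
                rw [← Functor.map_comp]; rfl
              rw [e, comp_obj, Functor.map_comp, ← hy₂, Category.assoc, Category.assoc,
                Hom.toF_comm_assoc, reassoc_of% hy₁ j, hwd, hwd] } }
  let r : F.toFunctor.obj c.pt.obj ⟶ c.pt.dom := hc.desc s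
  have hr (j : J) : F.toFunctor.map (ι j).obj ≫ r =
    y j ≫ (ι (Order.succ j)).dom := hc.fac s j
  refine ⟨r, ?_, ?_⟩
  · refine hdom.hom_ext fun j => ?_
    change (ι j).dom ≫ c.pt.toF ≫ r = (ι j).dom ≫ 𝟙 c.pt.dom
    rw [← Hom.toF_comm_assoc, hr, reassoc_of% hy₁ j, hwd, Category.comp_id]
  · refine hc.hom_ext fun j => ?_
    change F.toFunctor.map (ι j).obj ≫ r ≫ c.pt.toF =
      F.toFunctor.map (ι j).obj ≫ 𝟙 (F.toFunctor.obj c.pt.obj)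
    rw [reassoc_of% hr j, ← Hom.toF_comm, reassoc_of% hy₂ j, ← Functor.map_comp, hwo,
      Category.comp_id]

end PartialAlgebra

end PointedEndofunctor

end

/-! ### Free algebras and their preservation by exact functors -/

section

open Limits SmallObject

variable {E : Type u₁} [Category.{v₁} E] {E' : Type u₂} [Category.{v₂} E']

namespace PointedEndofunctor

/-- The map `u` exhibits the algebra `B` as the free algebra on the object `X`. -/
def IsFreeAlgebra {F : PointedEndofunctor E} (B : F.Algebra) {X : E} (u : X ⟶ B.carrier) : Prop :=
  ∀ (A : F.Algebra) (f : X ⟶ A.carrier), ∃! g : B.carrier ⟶ A.carrier,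
    B.str ≫ g = F.toFunctor.map g ≫ A.str ∧ u ≫ g = f

theorem IsFreeAlgebra.of_str_eq {F : PointedEndofunctor E} {B : F.Algebra} {X : E}
    {u : X ⟶ B.carrier} (h : IsFreeAlgebra B u)
    {s : F.toFunctor.obj B.carrier ⟶ B.carrier} (hs : s = B.str)
    {hu : F.unit.app B.carrier ≫ s = 𝟙 B.carrier} : IsFreeAlgebra ⟨B.carrier, s, hu⟩ u := by
  subst hs
  exact h

/-- The image of an algebra under a map of pointed endofunctors. -/
def Algebra.map {F : PointedEndofunctor E} {F' : PointedEndofunctor E'} (B : F.Algebra)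
    (P : E ⥤ E') (θ : F.toFunctor ⋙ P ≅ P ⋙ F'.toFunctor)
    (hθ : ∀ A, P.map (F.unit.app A) ≫ θ.hom.app A = F'.unit.app (P.obj A)) : F'.Algebra where
  carrier := P.obj B.carrier
  str := θ.inv.app B.carrier ≫ P.map B.str
  unit_str := by
    rw [← hθ, Category.assoc, Iso.hom_inv_id_app_assoc]
    exact (P.map_comp _ _).symm.trans ((congrArg P.map B.unit_str).trans (P.map_id _))

namespace PartialAlgebra

variable {F : PointedEndofunctor E} {M : MorphismProperty E}
  {F' : PointedEndofunctor E'} {M' : MorphismProperty E'}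

/-- The functor on partial algebras induced by a map of pointed endofunctors. -/
abbrev mapFunctor [M'.RespectsIso] (P : E ⥤ E') (hP : ∀ {A B : E} (f : A ⟶ B), M f → M' (P.map f))
    (θ : F.toFunctor ⋙ P ≅ P ⋙ F'.toFunctor)
    (hθ : ∀ A, P.map (F.unit.app A) ≫ θ.hom.app A = F'.unit.app (P.obj A)) :
    F.PartialAlgebra M ⥤ F'.PartialAlgebra M' where
  obj A :=
    { obj := P.obj A.obj
      dom := P.obj A.dom
      incl := P.map A.incl
      toF := P.map A.toF ≫ θ.hom.app A.obj
      str := P.map A.str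
      incl_toF := by rw [← Category.assoc, ← P.map_comp, A.incl_toF, hθ]
      incl_str := by rw [← P.map_comp, A.incl_str, P.map_id]
      mem := (M'.cancel_right_of_respectsIso _ _).2 (hP _ A.mem) }
  map {A B} f :=
    { obj := P.map f.obj
      dom := P.map f.dom
      incl_comm := by
        change P.map _ ≫ P.map _ = P.map _ ≫ P.map _
        rw [← P.map_comp, f.incl_comm, P.map_comp]
      toF_comm := by
        have := θ.hom.naturality f.obj
        dsimp at this
        change (P.map A.toF ≫ θ.hom.app A.obj) ≫ _ = P.map f.dom ≫ P.map B.toF ≫ θ.hom.app B.obj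
        rw [Category.assoc, ← this, ← P.map_comp_assoc, f.toF_comm, P.map_comp_assoc]
      str_comm := by
        change P.map _ ≫ P.map _ = P.map _ ≫ P.map _
        rw [← P.map_comp, f.str_comm, P.map_comp] }
  map_id A := hom_ext (P.map_id _) (P.map_id _)
  map_comp f g := hom_ext (P.map_comp _ _) (P.map_comp _ _)

/-- Both squares defining a step are pushouts along maps in `M`, so `P` preserves them. Only `F P ≅
P F'` has to be inserted. -/
theorem IsStep.map [M.IsMultiplicative] [M'.RespectsIso] (hM : HasPushouts M) {P : E ⥤ E'}
    (hP : ∀ {A B : E} (f : A ⟶ B), M f → M' (P.map f)) (hPp : PreservesPushouts M P)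
    (θ : F.toFunctor ⋙ P ≅ P ⋙ F'.toFunctor)
    (hθ : ∀ A, P.map (F.unit.app A) ≫ θ.hom.app A = F'.unit.app (P.obj A))
    {A B : F.PartialAlgebra M} {f : A ⟶ B} (hf : IsStep f) :
    IsStep ((mapFunctor (M' := M') P hP θ hθ).map f) := by
  have hfM := (hf.mem hM).1
  obtain ⟨y, h₁, h₂, h₃, h₄⟩ := hf
  have h₁' := hPp _ _ _ _ A.mem h₁
  have h₂' := hPp _ _ _ _ hfM h₂
  refine ⟨θ.inv.app A.obj ≫ P.map y, ?_, ?_, ?_, ?_⟩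
  · refine IsPushout.of_iso h₁' (Iso.refl _) (θ.app A.obj) (Iso.refl _) (Iso.refl _) ?_ ?_ ?_ ?_
    · simp
    · simp
    · simp
    · simp
  · refine IsPushout.of_iso h₂' (Iso.refl _) (Iso.refl _) (θ.app A.obj) (Iso.refl _) ?_ ?_ ?_ ?_
    · simp
    · simp [hθ]
    · simp
    · simp
  · rw [Category.assoc, Iso.hom_inv_id_app_assoc, ← P.map_comp, h₃]
  · have := θ.hom.naturality f.obj
    dsimp at this
    rw [Category.assoc, ← P.map_comp_assoc, h₄, this, Iso.inv_hom_id_app_assoc]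

theorem IsStepSequence.map {κ : Ordinal.{w}} (hF : F.IsConfiguration κ M) [M'.RespectsIso]
    {P : E ⥤ E'} (hP : IsExactMap κ M M' P) (θ : F.toFunctor ⋙ P ≅ P ⋙ F'.toFunctor)
    (hθ : ∀ A, P.map (F.unit.app A) ≫ θ.hom.app A = F'.unit.app (P.obj A))
    {J : Type w} [LinearOrder J] [WellFoundedLT J]
    (hJ : Ordinal.type ((· < ·) : J → J → Prop) ≤ κ) {D : J ⥤ F.PartialAlgebra M}
    (hD : IsStepSequence D) :
    IsStepSequence (D ⋙ mapFunctor (M' := M') P hP.map_mem θ hθ) where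
  obj_chain := hP.isChain hJ hD.obj_chain
  dom_chain := hP.isChain hJ hD.dom_chain
  step a b h := by
    have := hF.compositions.isMultiplicative
    exact (hD.step a b h).map hF.pushouts hP.map_mem hP.pushouts θ hθ

/-- Maps from the first stage to an algebra extend uniquely to the colimit, and maps from a discrete
first stage are just morphisms of the category. The hypotheses mention only the sequence and its
colimit, so the lemma also applies to the image of a sequence under a functor. -/
theorem IsStepSequence.isFreeAlgebra [M.ContainsIdentities] {J : Type w} [LinearOrder J]
    [OrderBot J] [SuccOrder J] [WellFoundedLT J] {D : J ⥤ F.PartialAlgebra M}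
    (hD : IsStepSequence D) [IsIso (D.obj ⊥).incl] {c : Cocone D}
    (hobj : IsColimit ((objFunctor F M).mapCocone c))
    (hdom : IsColimit ((domFunctor F M).mapCocone c)) [IsIso c.pt.toF] {X : E}
    (i : X ⟶ (D.obj ⊥).obj) [IsIso i] :
    IsFreeAlgebra c.pt.toAlgebra (i ≫ (c.ι.app ⊥).obj) := by
  intro A f
  -- With `incl` invertible, the operation is defined on units only, so any morphism to an algebra
  -- respects it by the unit law.
  have hbot : (D.obj ⊥).toF = (D.obj ⊥).str ≫ F.unit.app (D.obj ⊥).obj := by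
    rw [← cancel_epi (D.obj ⊥).incl, incl_toF, incl_str_assoc]
  let g₀ : D.obj ⊥ ⟶ ofAlgebra M A := homOfAlgebra (inv i ≫ f) (by
    have := F.unit.naturality (inv i ≫ f)
    dsimp only [Functor.id_obj, Functor.id_map] at this
    rw [hbot, Category.assoc, ← reassoc_of% this, A.unit_str, Category.comp_id])
  have hbij := hD.bijective_comp hobj hdom A
  obtain ⟨g, hg⟩ := hbij.2 g₀
  have hg' : (c.ι.app ⊥).obj ≫ g.obj = inv i ≫ f := congrArg Hom.obj hg
  refine ⟨g.obj, ⟨?_, ?_⟩, ?_⟩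
  · have := str_eq_of_hom_ofAlgebra g
    dsimp only
    rw [Category.assoc, this, IsIso.inv_hom_id_assoc]
  · rw [Category.assoc, hg', IsIso.hom_inv_id_assoc]
  · rintro k ⟨hk₁, hk₂⟩
    have hk₃ : c.pt.str ≫ k = c.pt.toF ≫ F.toFunctor.map k ≫ A.str := by
      rw [← hk₁, Category.assoc, IsIso.hom_inv_id_assoc]
    have : (homOfAlgebra k hk₃ : c.pt ⟶ ofAlgebra M A) = g := by
      apply hbij.1
      refine Eq.trans ?_ hg.symm
      apply hom_ofAlgebra_ext
      change (c.ι.app ⊥).obj ≫ k = inv i ≫ f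
      rw [← hk₂, Category.assoc, IsIso.inv_hom_id_assoc]
    exact congrArg Hom.obj this

end PartialAlgebra

/-- Free algebras on the pointed endofunctor of a configuration exist and are preserved by maps of
configurations. -/
theorem exists_isFreeAlgebra {κ : Ordinal.{w}} (hκ : IsRegularOrdinal κ)
    {F : PointedEndofunctor E} {M : MorphismProperty E} (hF : F.IsConfiguration κ M) (X : E) :
    ∃ (B : F.Algebra) (u : X ⟶ B.carrier), ∀ {E' : Type u₂} [Category.{v₂} E']
      {F' : PointedEndofunctor E'} {M' : MorphismProperty E'} (_ : F'.IsConfiguration κ M')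
      (P : E ⥤ E') (_ : IsExactMap κ M M' P) (θ : F.toFunctor ⋙ P ≅ P ⋙ F'.toFunctor)
      (hθ : ∀ A, P.map (F.unit.app A) ≫ θ.hom.app A = F'.unit.app (P.obj A)),
      IsFreeAlgebra (B.map P θ hθ) (P.map u) := by
  -- By regularity this has order type `κ`. Written as the initial ordinal of an infinite cardinal,
  -- it visibly has no greatest element.
  let J := κ.cof.ord.ToType
  have hJ : Ordinal.type ((· < ·) : J → J → Prop) = κ := (Ordinal.type_toType _).trans hκ.2
  have hcof : Cardinal.aleph0 ≤ κ.cof := by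
    rw [← Cardinal.omega0_le_ord, hκ.2]
    exact hκ.1
  have : NoMaxOrder J := Cardinal.noMaxOrder hcof
  have : Nonempty J := Ordinal.nonempty_toType_iff.2 (by
    rw [hκ.2]
    exact (Ordinal.omega0_pos.trans_le hκ.1).ne')
  let _ : OrderBot J := WellFoundedLT.toOrderBot J
  let _ : SuccOrder J := SuccOrder.ofLinearWellFoundedLT J
  obtain ⟨D, hD, ⟨e⟩⟩ := PartialAlgebra.exists_isStepSequence hF X J hJ.le
  have := PartialAlgebra.hasColimit_of_isChain hF hJ.le hD.obj_chain hD.dom_chain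
  obtain ⟨⟨hobj⟩, ⟨hdom⟩⟩ := PartialAlgebra.nonempty_isColimit_components_of_isChain hF hJ.le
    hD.obj_chain hD.dom_chain (colimit.isColimit D)
  have := hD.isIso_toF hF hJ hobj hdom
  let i : X ≅ (D.obj ⊥).obj := (PartialAlgebra.objFunctor F M).mapIso e.symm
  have hincl : IsIso (D.obj ⊥).incl := by
    have h : (D.obj ⊥).incl ≫ e.hom.dom = e.hom.obj ≫ 𝟙 X := e.hom.incl_comm
    let e₁ : (D.obj ⊥).obj ≅ X := (PartialAlgebra.objFunctor F M).mapIso e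
    let e₂ : (D.obj ⊥).dom ≅ X := (PartialAlgebra.domFunctor F M).mapIso e
    have h' : (D.obj ⊥).incl = e₁.hom ≫ e₂.inv := by
      rw [Iso.eq_comp_inv]
      exact h.trans (Category.comp_id _)
    rw [h']
    infer_instance
  refine ⟨(colimit.cocone D).pt.toAlgebra, i.hom ≫ ((colimit.cocone D).ι.app ⊥).obj, ?_⟩
  intro E' _ F' M' hF' P hP θ hθ
  have := hF'.compositions.isMultiplicative
  have := hF'.pushouts.respectsIso
  have := hP.compositions J hJ.le _ hD.obj_chain
  have := hP.compositions J hJ.le _ hD.dom_chain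
  let Q := PartialAlgebra.mapFunctor (M := M) (M' := M') P hP.map_mem θ hθ
  let k := (colimit.cocone D).pt
  -- The image of the sequence still has a discrete first stage and a total colimit, since
  -- isomorphisms are preserved. Freeness in the target then needs no separate convergence argument.
  have : IsIso ((D ⋙ Q).obj ⊥).incl := inferInstanceAs (IsIso (P.map (D.obj ⊥).incl))
  have : IsIso (Q.mapCocone (colimit.cocone D)).pt.toF :=
    inferInstanceAs (IsIso (P.map k.toF ≫ θ.hom.app k.obj))
  have h := (hD.map hF hP θ hθ hJ.le).isFreeAlgebra (c := Q.mapCocone (colimit.cocone D))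
    (isColimitOfPreserves P hobj) (isColimitOfPreserves P hdom) (P.map i.hom)
  have hu : P.map (i.hom ≫ ((colimit.cocone D).ι.app ⊥).obj) =
    P.map i.hom ≫ P.map ((colimit.cocone D).ι.app ⊥).obj := P.map_comp _ _
  have hs : θ.inv.app k.obj ≫ P.map (inv k.toF ≫ k.str) =
      inv (P.map k.toF ≫ θ.hom.app k.obj) ≫ P.map k.str := by
    simp
  rw [hu]
  exact h.of_str_eq hs

end PointedEndofunctor

end

/-! ## Monads whose values are free algebras -/

section

variable {E : Type u₁} [Category.{v₁} E]

namespace PointedEndofunctor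

theorem IsFreeAlgebra.hom_ext {F : PointedEndofunctor E} {B : F.Algebra} {X : E}
    {u : X ⟶ B.carrier} (h : IsFreeAlgebra B u) (A : F.Algebra) {g g' : B.carrier ⟶ A.carrier}
    (hg : B.str ≫ g = F.toFunctor.map g ≫ A.str) (hg' : B.str ≫ g' = F.toFunctor.map g' ≫ A.str)
    (e : u ≫ g = u ≫ g') : g = g' :=
  (h A (u ≫ g')).unique ⟨hg, e⟩ ⟨hg', rfl⟩

namespace MapToMonad

variable {F : PointedEndofunctor E} {R : Monad E} (σ : F.MapToMonad R)

/-- The values of the monad are free algebras. -/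
def FreeValues : Prop :=
  ∀ A : E, IsFreeAlgebra (σ.restrict.obj (R.free.obj A)) (R.η.app A)

/-- The map `σ` is recovered from the algebra structure on `R A` and the unit, by the right unit law
of the monad. -/
theorem app_eq (A : E) : σ.toNatTrans.app A =
    F.toFunctor.map (R.η.app A) ≫ σ.toNatTrans.app (R.obj A) ≫ R.μ.app A := by
  rw [σ.toNatTrans.naturality_assoc]
  exact ((congrArg (σ.toNatTrans.app A ≫ ·) (R.right_unit A)).trans (Category.comp_id _)).symm

/-- Here and in the next two lemmas, `R f`, the multiplication and the structure map of an
`R`-algebra are seen to be maps of `F`-algebras. Uniqueness of extensions can then be applied to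
them. -/
theorem map_comm {A B : E} (f : A ⟶ B) :
    (σ.toNatTrans.app (R.obj A) ≫ R.μ.app A) ≫ R.map f =
      F.toFunctor.map (R.map f) ≫ σ.toNatTrans.app (R.obj B) ≫ R.μ.app B := by
  rw [σ.toNatTrans.naturality_assoc, Category.assoc]
  exact congrArg (σ.toNatTrans.app _ ≫ ·) (R.μ.naturality f).symm

theorem mul_comm (A : E) :
    (σ.toNatTrans.app (R.obj (R.obj A)) ≫ R.μ.app (R.obj A)) ≫ R.μ.app A =
      F.toFunctor.map (R.μ.app A) ≫ σ.toNatTrans.app (R.obj A) ≫ R.μ.app A := by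
  rw [σ.toNatTrans.naturality_assoc, Category.assoc]
  exact congrArg (σ.toNatTrans.app _ ≫ ·) (R.assoc A).symm

theorem str_comm (A : R.Algebra) :
    (σ.toNatTrans.app (R.obj A.A) ≫ R.μ.app A.A) ≫ A.a =
      F.toFunctor.map A.a ≫ σ.toNatTrans.app A.A ≫ A.a := by
  rw [σ.toNatTrans.naturality_assoc, Category.assoc, A.assoc]

variable {σ}

theorem FreeValues.hom_ext (h : σ.FreeValues) {X Z : E} {c : F.toFunctor.obj Z ⟶ Z}
    (hc : F.unit.app Z ≫ c = 𝟙 Z) {g g' : R.obj X ⟶ Z}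
    (hg : (σ.toNatTrans.app (R.obj X) ≫ R.μ.app X) ≫ g = F.toFunctor.map g ≫ c)
    (hg' : (σ.toNatTrans.app (R.obj X) ≫ R.μ.app X) ≫ g' = F.toFunctor.map g' ≫ c)
    (e : R.η.app X ≫ g = R.η.app X ≫ g') : g = g' :=
  (h X).hom_ext ⟨Z, c, hc⟩ hg hg' e

theorem FreeValues.exists_extension (h : σ.FreeValues) {X : E} (A : F.Algebra)
    (f : X ⟶ A.carrier) : ∃ g : R.obj X ⟶ A.carrier,
      (σ.toNatTrans.app (R.obj X) ≫ R.μ.app X) ≫ g = F.toFunctor.map g ≫ A.str ∧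
        R.η.app X ≫ g = f :=
  (h X A f).exists

/-- `φ A` is the extension of the unit of `S` to the `F`-algebra on `S A` given by `τ`. Naturality,
multiplicativity and uniqueness each compare two algebra maps out of a free algebra that agree on
generators. -/
theorem FreeValues.isFreeMonad (h : σ.FreeValues) : IsFreeMonad σ := by
  intro S τ
  have hex (A : E) : ∃ φ : R.obj A ⟶ S.obj A, (σ.toNatTrans.app (R.obj A) ≫ R.μ.app A) ≫ φ =
      F.toFunctor.map φ ≫ τ.toNatTrans.app (S.obj A) ≫ S.μ.app A ∧ R.η.app A ≫ φ = S.η.app A :=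
    h.exists_extension (τ.restrict.obj (S.free.obj A)) (S.η.app A)
  choose φ hφ₁ hφ₂ using hex
  have hunit (A : E) : F.unit.app (S.obj A) ≫ τ.toNatTrans.app (S.obj A) ≫ S.μ.app A = 𝟙 _ :=
    (τ.restrict.obj (S.free.obj A)).unit_str
  have hnat {A B : E} (f : A ⟶ B) : R.map f ≫ φ B = φ A ≫ S.map f := by
    apply h.hom_ext (hunit B)
    · rw [← Category.assoc, σ.map_comm, Category.assoc, hφ₁, Functor.map_comp, Category.assoc]
    · rw [← Category.assoc, hφ₁, Category.assoc, τ.map_comm, Functor.map_comp, Category.assoc]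
    · have h₁ := R.η.naturality f
      have h₂ := S.η.naturality f
      dsimp at h₁ h₂
      rw [← reassoc_of% h₁, hφ₂, ← Category.assoc (R.η.app A)]
      exact h₂.trans (congrArg (· ≫ S.map f) (hφ₂ A).symm)
  have hmul (A : E) : R.μ.app A ≫ φ A = (R.map (φ A) ≫ φ (S.obj A)) ≫ S.μ.app A := by
    apply h.hom_ext (hunit A)
    · rw [← Category.assoc, σ.mul_comm, Category.assoc, hφ₁, Functor.map_comp, Category.assoc]
    · rw [Category.assoc (R.map _), ← Category.assoc, σ.map_comm, Category.assoc, Category.assoc,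
        reassoc_of% hφ₁, Functor.map_comp, Functor.map_comp, Category.assoc, Category.assoc, ← τ.mul_comm,
        Category.assoc]
    · have h₁ := R.η.naturality (φ A)
      dsimp at h₁
      have h₂ : R.η.app (R.obj A) ≫ R.μ.app A = 𝟙 _ := R.left_unit A
      have h₃ : S.η.app (S.obj A) ≫ S.μ.app A = 𝟙 _ := S.left_unit A
      rw [reassoc_of% h₂, Category.assoc, ← reassoc_of% h₁, reassoc_of% hφ₂, h₃]
      exact (Category.comp_id _).symm
  have hσ (A : E) : σ.toNatTrans.app A ≫ φ A = τ.toNatTrans.app A := by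
    rw [σ.app_eq, τ.app_eq, Category.assoc, hφ₁, ← Functor.map_comp_assoc, hφ₂]
  refine ⟨{ app := φ, naturality := fun _ _ f => hnat f, app_η := hφ₂, app_μ := hmul }, hσ,
    fun ψ hψ => ?_⟩
  ext A
  change ψ.app A = φ A
  apply h.hom_ext (hunit A)
  · rw [Category.assoc, ψ.app_μ, ← hψ, Category.assoc, Category.assoc,
      σ.toNatTrans.naturality_assoc]
  · exact hφ₁ A
  · rw [hφ₂, ψ.app_η]

/-- The action is the extension of the identity of `C`: evaluation of formal operations.
Associativity holds because both sides are algebra maps out of `R (R C)` that agree on generators.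
-/
theorem FreeValues.exists_str (h : σ.FreeValues) (C : F.Algebra) :
    ∃ a : R.obj C.carrier ⟶ C.carrier, R.η.app C.carrier ≫ a = 𝟙 _ ∧
      R.μ.app C.carrier ≫ a = R.map a ≫ a ∧ σ.toNatTrans.app C.carrier ≫ a = C.str := by
  obtain ⟨a, h₁, h₂⟩ := h.exists_extension C (𝟙 _)
  refine ⟨a, h₂, ?_, ?_⟩
  · apply h.hom_ext C.unit_str
    · rw [← Category.assoc, σ.mul_comm, Category.assoc, h₁, Functor.map_comp, Category.assoc]
    · rw [← Category.assoc, σ.map_comm, Category.assoc, h₁, Functor.map_comp, Category.assoc]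
    · have h₃ := R.η.naturality a
      dsimp at h₃
      have h₄ : R.η.app (R.obj C.carrier) ≫ R.μ.app C.carrier = 𝟙 _ := R.left_unit _
      rw [reassoc_of% h₄, ← reassoc_of% h₃, h₂, Category.comp_id]
  · rw [σ.app_eq, Category.assoc, h₁, ← Functor.map_comp_assoc, h₂]
    exact (congrArg (· ≫ C.str) (F.toFunctor.map_id C.carrier)).trans (Category.id_comp _)

theorem FreeValues.map_comp_str (h : σ.FreeValues) {A B : R.Algebra} (g : A.A ⟶ B.A)
    (hg : (σ.toNatTrans.app A.A ≫ A.a) ≫ g =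
      F.toFunctor.map g ≫ σ.toNatTrans.app B.A ≫ B.a) : R.map g ≫ B.a = A.a ≫ g := by
  have hB : F.unit.app B.A ≫ σ.toNatTrans.app B.A ≫ B.a = 𝟙 B.A := (σ.restrict.obj B).unit_str
  apply h.hom_ext hB
  · rw [← Category.assoc, σ.map_comm, Category.assoc, σ.str_comm, Functor.map_comp,
      Category.assoc]
  · rw [← Category.assoc, σ.str_comm, Category.assoc, hg, Functor.map_comp, Category.assoc]
  · have h₁ : R.η.app A.A ≫ R.map g = g ≫ R.η.app B.A := (R.η.naturality g).symm
    rw [reassoc_of% h₁, A.unit_assoc]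
    exact (congrArg (g ≫ ·) B.unit).trans (Category.comp_id _)

theorem FreeValues.isAlgebraicallyFreeMonad (h : σ.FreeValues) : IsAlgebraicallyFreeMonad σ where
  full := ⟨fun {A B} g => ⟨⟨g.hom, h.map_comp_str g.hom g.comm⟩, rfl⟩⟩
  faithful := ⟨fun {A B} g g' e => Monad.Algebra.Hom.ext (congrArg Algebra.Hom.hom e)⟩
  bijective := by
    constructor
    · intro A B e
      obtain ⟨A, a, ha, ha'⟩ := A
      obtain ⟨B, b, hb, hb'⟩ := B
      obtain rfl : A = B := congrArg Algebra.carrier e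
      have e' : σ.toNatTrans.app A ≫ a = σ.toNatTrans.app A ≫ b := by
        have := (Algebra.mk.injEq _ _ _ _ _ _).mp e
        exact eq_of_heq this.2
      have ha'' := σ.str_comm ⟨A, a, ha, ha'⟩
      have hb'' := σ.str_comm ⟨A, b, hb, hb'⟩
      dsimp only at ha'' hb''
      -- Both actions are maps from `R A` to the same `F`-algebra that extend the identity.
      obtain rfl : a = b := by
        apply h.hom_ext (σ.restrict.obj ⟨A, a, ha, ha'⟩).unit_str
        · exact ha''
        · change _ = F.toFunctor.map b ≫ σ.toNatTrans.app A ≫ a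
          rw [e']
          exact hb''
        · exact ha.trans hb.symm
      rfl
    · intro C
      obtain ⟨a, h₁, h₂, h₃⟩ := h.exists_str C
      refine ⟨⟨C.carrier, a, h₁, h₂⟩, ?_⟩
      obtain ⟨C, c, hc⟩ := C
      dsimp only [restrict]
      congr 1

end MapToMonad

end PointedEndofunctor

/-! ## Monoids acting on free algebras -/

section Monoidal

variable [MonoidalCategory E] {T : E} {η : 𝟙_ E ⟶ T} {M : E} [MonObj M] {ι : T ⟶ M}

/-- The map of pointed endofunctors `T ⊗ (-) ⟶ M ⊗ (-)` induced by a map of pointed objects. -/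
def tensorMapToMonad (hι : η ≫ ι = MonObj.one) :
    (tensorPointed T η).MapToMonad (tensorMonad M) where
  toNatTrans :=
    { app := fun A => ι ▷ A
      naturality := fun A B f => whisker_exchange _ _ }
  unit_comp A := by
    change ((λ_ A).inv ≫ η ▷ A) ≫ ι ▷ A = (λ_ A).inv ≫ MonObj.one ▷ A
    rw [Category.assoc, ← comp_whiskerRight, hι]

/-- The algebra of the monad `M ⊗ (-)` on an object with an action of `M`. -/
abbrev algebraOfMod (A : Mod E M) : (tensorMonad M).Algebra where
  A := A.X
  a := ModObj.smul (M := M) (X := A.X)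
  unit := by
    change ((λ_ A.X).inv ≫ MonObj.one ▷ A.X) ≫ ModObj.smul (M := M) (X := A.X) = 𝟙 A.X
    rw [Category.assoc, ModObj.one_smul_self, Iso.inv_hom_id]
  assoc := by
    change ((α_ M M A.X).inv ≫ MonObj.mul ▷ A.X) ≫ ModObj.smul (M := M) (X := A.X) =
      M ◁ ModObj.smul (M := M) (X := A.X) ≫ ModObj.smul (M := M) (X := A.X)
    rw [Category.assoc, ModObj.mul_smul_self, Iso.inv_hom_id_assoc]

theorem one_smul_of_unit (X : E) (a : M ⊗ X ⟶ X)
    (h : ((λ_ X).inv ≫ MonObj.one ▷ X) ≫ a = 𝟙 X) : MonObj.one ▷ X ≫ a = (λ_ X).hom := by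
  rwa [Category.assoc, Iso.inv_comp_eq, Category.comp_id] at h

theorem mul_smul_of_assoc (X : E) (a : M ⊗ X ⟶ X)
    (h : ((α_ M M X).inv ≫ MonObj.mul ▷ X) ≫ a = M ◁ a ≫ a) :
    MonObj.mul ▷ X ≫ a = (α_ M M X).hom ≫ M ◁ a ≫ a := by
  rwa [Category.assoc, Iso.inv_comp_eq] at h

/-- The object with an action of `M` underlying an algebra of the monad `M ⊗ (-)`. -/
abbrev modOfAlgebra (A : (tensorMonad M).Algebra) : Mod E M where
  X := A.A
  mod :=
    { smul := (A.a : M ⊗ A.A ⟶ A.A)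
      one_smul := one_smul_of_unit A.A A.a A.unit
      mul_smul := mul_smul_of_assoc A.A A.a A.assoc }

/-- Objects with an `M`-action and algebras of the monad `M ⊗ (-)` are the same data up to
rearranging associators and unitors, so the monad statement transfers. -/
theorem isAlgebraicallyFreeMonoid_of_freeValues {hι : η ≫ ι = MonObj.one}
    (h : (tensorMapToMonad hι).FreeValues) : IsAlgebraicallyFreeMonoid η M ι := by
  obtain ⟨hfull, hfaith, hinj, hsurj⟩ := h.isAlgebraicallyFreeMonad
  have key (A : Mod E M) : (restrictModules η M ι hι).obj A =
    (tensorMapToMonad hι).restrict.obj (algebraOfMod A) := rfl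
  refine ⟨hι, ⟨fun {A B} g => ?_⟩, ⟨fun {A B} g g' e => ?_⟩, fun A B e => ?_, fun C => ?_⟩
  · obtain ⟨g', hg'⟩ := (tensorMapToMonad hι).restrict.map_surjective
      (X := algebraOfMod A) (Y := algebraOfMod B) g
    refine ⟨Mod.Hom.mk' g'.f g'.h.symm, ?_⟩
    exact hg'
  · exact Mod.hom_ext _ _ (congrArg PointedEndofunctor.Algebra.Hom.hom e)
  · have e' := hinj (a₁ := algebraOfMod A) (a₂ := algebraOfMod B) e
    exact congrArg modOfAlgebra e'
  · obtain ⟨A, hA⟩ := hsurj C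
    exact ⟨modOfAlgebra A, hA⟩

end Monoidal

end

/-! ## Monoids from free actions -/

section

variable {E : Type u₁} [Category.{v₁} E] [MonoidalCategory E]

/-- The map `m : T ⊗ M ⟶ M` makes `M ⊗ A`, for all `A`, a free algebra on `A` for the pointed
endofunctor `T ⊗ (-)`. -/
structure IsFreeAction {T : E} (η : 𝟙_ E ⟶ T) {M : E} (m : T ⊗ M ⟶ M) (u : 𝟙_ E ⟶ M) : Prop where
  unit_str : ((λ_ M).inv ≫ η ▷ M) ≫ m = 𝟙 M
  existsUnique : ∀ (A X : E) (a : T ⊗ X ⟶ X), ((λ_ X).inv ≫ η ▷ X) ≫ a = 𝟙 X → ∀ f : A ⟶ X,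
    ∃! g : M ⊗ A ⟶ X,
      ((α_ T M A).inv ≫ m ▷ A) ≫ g = T ◁ g ≫ a ∧ ((λ_ A).inv ≫ u ▷ A) ≫ g = f

namespace IsFreeAction

variable {T : E} {η : 𝟙_ E ⟶ T} {M : E}

section

variable {m : T ⊗ M ⟶ M} {u : 𝟙_ E ⟶ M} (h : IsFreeAction η m u)

include h

theorem hom_ext {A X : E} {a : T ⊗ X ⟶ X} (ha : ((λ_ X).inv ≫ η ▷ X) ≫ a = 𝟙 X)
    {g g' : M ⊗ A ⟶ X} (hg : m ▷ A ≫ g = (α_ T M A).hom ≫ T ◁ g ≫ a)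
    (hg' : m ▷ A ≫ g' = (α_ T M A).hom ≫ T ◁ g' ≫ a) (e : u ▷ A ≫ g = u ▷ A ≫ g') : g = g' :=
  (h.existsUnique A X a ha (((λ_ A).inv ≫ u ▷ A) ≫ g)).unique
    ⟨by rw [Category.assoc, hg, Iso.inv_hom_id_assoc], rfl⟩
    ⟨by rw [Category.assoc, hg', Iso.inv_hom_id_assoc], by rw [Category.assoc, Category.assoc, e]⟩

theorem exists_extension {A X : E} {a : T ⊗ X ⟶ X} (ha : ((λ_ X).inv ≫ η ▷ X) ≫ a = 𝟙 X)
    (f : A ⟶ X) : ∃ g : M ⊗ A ⟶ X,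
      m ▷ A ≫ g = (α_ T M A).hom ≫ T ◁ g ≫ a ∧ u ▷ A ≫ g = (λ_ A).hom ≫ f := by
  obtain ⟨g, h₁, h₂⟩ := (h.existsUnique A X a ha f).exists
  refine ⟨g, ?_, ?_⟩
  · rw [← h₁, Category.assoc, Iso.hom_inv_id_assoc]
  · rw [← h₂, Category.assoc, Iso.hom_inv_id_assoc]

/-- The case `A = 𝟙_`, transported along `M ⊗ 𝟙_ ≅ M`. -/
theorem hom_ext_unit {X : E} {a : T ⊗ X ⟶ X} (ha : ((λ_ X).inv ≫ η ▷ X) ≫ a = 𝟙 X)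
    {g g' : M ⟶ X} (hg : m ≫ g = T ◁ g ≫ a) (hg' : m ≫ g' = T ◁ g' ≫ a)
    (e : u ≫ g = u ≫ g') : g = g' := by
  rw [← cancel_epi (ρ_ M).hom]
  apply h.hom_ext ha
  · rw [rightUnitor_naturality_assoc, hg]
    simp
  · rw [rightUnitor_naturality_assoc, hg']
    simp
  · rw [rightUnitor_naturality_assoc, rightUnitor_naturality_assoc, e]

theorem exists_extension_unit {X : E} {a : T ⊗ X ⟶ X} (ha : ((λ_ X).inv ≫ η ▷ X) ≫ a = 𝟙 X)
    (f : 𝟙_ E ⟶ X) : ∃ g : M ⟶ X, m ≫ g = T ◁ g ≫ a ∧ u ≫ g = f := by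
  obtain ⟨g, h₁, h₂⟩ := h.exists_extension ha f
  refine ⟨(ρ_ M).inv ≫ g, ?_, ?_⟩
  · rw [rightUnitor_inv_naturality_assoc, h₁]
    simp
  · rw [rightUnitor_inv_naturality_assoc, h₂, unitors_equal]
    simp

/-- The multiplication is the extension of `𝟙 M` to `M ⊗ M`, the free algebra on `M`; the left unit
law is its defining property. The right unit law and associativity compare algebra maps out of `M ⊗
𝟙_` and `M ⊗ (M ⊗ M)`, which is why freeness of `M ⊗ A` is needed for more than the unit. The map
`ι` applies `m` to the unit of `M`. -/
theorem exists_monObj : ∃ (_ : MonObj M) (ι : T ⟶ M), (MonObj.one : 𝟙_ E ⟶ M) = u ∧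
    ι ▷ M ≫ MonObj.mul = m ∧ η ≫ ι = MonObj.one := by
  obtain ⟨mul, h₁, h₂⟩ := h.exists_extension h.unit_str (𝟙 M)
  rw [Category.comp_id] at h₂
  have hη : η ▷ M ≫ m = (λ_ M).hom := by
    have := h.unit_str
    rwa [Category.assoc, Iso.inv_comp_eq, Category.comp_id] at this
  have hmul_one : M ◁ u ≫ mul = (ρ_ M).hom := by
    apply h.hom_ext h.unit_str
    · rw [← whisker_exchange_assoc, h₁]
      simp
    · rw [rightUnitor_naturality]
      simp
    · rw [← whisker_exchange_assoc, h₂]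
      simp [unitors_equal]
  have hassoc : (α_ M M M).inv ≫ mul ▷ M ≫ mul = M ◁ mul ≫ mul := by
    apply h.hom_ext h.unit_str
    · have e : m ▷ (M ⊗ M) ≫ (α_ M M M).inv = (α_ (T ⊗ M) M M).inv ≫ (m ▷ M) ▷ M := by simp
      rw [reassoc_of% e, ← comp_whiskerRight_assoc, h₁, comp_whiskerRight_assoc,
        comp_whiskerRight_assoc, h₁]
      simp
    · rw [← whisker_exchange_assoc, h₁]
      simp
    · have e : u ▷ (M ⊗ M) ≫ (α_ M M M).inv = (α_ (𝟙_ E) M M).inv ≫ (u ▷ M) ▷ M := by simp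
      rw [reassoc_of% e, ← comp_whiskerRight_assoc, h₂, ← whisker_exchange_assoc, h₂]
      simp
  refine ⟨{ one := u, mul := mul, one_mul := h₂, mul_one := hmul_one, mul_assoc := ?_ },
    (ρ_ T).inv ≫ T ◁ u ≫ m, rfl, ?_, ?_⟩
  · rw [← hassoc, Iso.hom_inv_id_assoc]
  · change ((ρ_ T).inv ≫ T ◁ u ≫ m) ▷ M ≫ mul = m
    have e : (T ◁ u) ▷ M ≫ (α_ T M M).hom = (α_ T (𝟙_ E) M).hom ≫ T ◁ u ▷ M := by simp
    rw [comp_whiskerRight_assoc, comp_whiskerRight_assoc, h₁, reassoc_of% e,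
      ← MonoidalCategory.whiskerLeft_comp_assoc, h₂]
    simp
  · change η ≫ (ρ_ T).inv ≫ T ◁ u ≫ m = u
    rw [rightUnitor_inv_naturality_assoc, ← whisker_exchange_assoc, hη, leftUnitor_naturality,
      unitors_equal, Iso.inv_hom_id_assoc]

end

variable [MonObj M] {ι : T ⟶ M}

theorem unit_mul {N : E} [MonObj N] {τ : T ⟶ N} (hτ : η ≫ τ = MonObj.one) :
    ((λ_ N).inv ≫ η ▷ N) ≫ τ ▷ N ≫ MonObj.mul = 𝟙 N := by
  rw [Category.assoc, ← comp_whiskerRight_assoc, hτ, MonObj.one_mul, Iso.inv_hom_id]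

theorem mul_mul {N : E} [MonObj N] (τ : T ⟶ N) :
    (τ ▷ N ≫ MonObj.mul) ▷ N ≫ MonObj.mul =
      (α_ T N N).hom ≫ T ◁ MonObj.mul ≫ τ ▷ N ≫ MonObj.mul := by
  rw [comp_whiskerRight_assoc, MonObj.mul_assoc, whisker_exchange_assoc]
  simp

theorem one_mul_eq {N : E} [MonObj N] (τ : T ⟶ N) :
    (ρ_ T).inv ≫ T ◁ MonObj.one ≫ τ ▷ N ≫ MonObj.mul = τ := by
  rw [whisker_exchange_assoc, MonObj.mul_one, rightUnitor_naturality, Iso.inv_hom_id_assoc]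

variable (h : IsFreeAction η (ι ▷ M ≫ MonObj.mul) MonObj.one)

include h

/-- Multiplication through `τ` makes `N` an algebra, and `φ` extends its unit. Multiplicativity
follows by uniqueness on `M ⊗ M`. Conversely, a monoid map compatible with `τ` is an algebra map
that preserves the unit, so it equals `φ`. -/
theorem isFreeMonoid (hι : η ≫ ι = MonObj.one) : IsFreeMonoid η M ι := by
  refine ⟨hι, fun N _ τ hτ => ?_⟩
  obtain ⟨φ, h₁, h₂⟩ := h.exists_extension_unit (unit_mul hτ) MonObj.one
  refine ⟨φ, ⟨⟨h₂, ?_⟩, ?_⟩, fun ψ hψ => ?_⟩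
  · apply h.hom_ext (unit_mul hτ)
    · rw [reassoc_of% mul_mul ι]
      simp only [Category.assoc] at h₁
      rw [h₁]
      simp
    · rw [MonoidalCategory.tensorHom_def, Category.assoc, ← comp_whiskerRight_assoc, h₁,
        comp_whiskerRight_assoc, ← whisker_exchange_assoc, mul_mul]
      simp
    · rw [MonObj.one_mul_assoc, MonoidalCategory.tensorHom_def, Category.assoc, ← comp_whiskerRight_assoc,
        h₂, ← whisker_exchange_assoc, MonObj.one_mul, leftUnitor_naturality]
  · rw [← one_mul_eq ι, Category.assoc, Category.assoc, h₁,
      ← MonoidalCategory.whiskerLeft_comp_assoc, h₂, one_mul_eq]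
  · obtain ⟨hψ, rfl⟩ := hψ
    apply h.hom_ext_unit (unit_mul hτ)
    · rw [Category.assoc, IsMonHom.mul_hom, tensorHom_def', comp_whiskerRight,
        Category.assoc, Category.assoc, ← whisker_exchange_assoc]
    · exact h₁
    · rw [h₂, IsMonHom.one_hom]

/-- The algebra structure that the monad puts on `M ⊗ A` is the free action tensored with `A`, up to
the associator. -/
theorem freeValues (hι : η ≫ ι = MonObj.one) : (tensorMapToMonad (M := M) hι).FreeValues := by
  intro A
  have e : ι ▷ (M ⊗ A) ≫ (α_ M M A).inv ≫ MonObj.mul ▷ A =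
      (α_ T M A).inv ≫ (ι ▷ M ≫ MonObj.mul) ▷ A := by simp
  rintro ⟨X, a, ha⟩ f
  have := h.existsUnique A X a ha f
  rw [← e] at this
  exact this

end IsFreeAction

end

/-! ## Images of free monoids under strong monoidal functors -/

section

variable {C : Type u₁} [Category.{v₁} C] [MonoidalCategory C]
  {D : Type u₂} [Category.{v₂} D] [MonoidalCategory D]
  {D' : Type u₃} [Category.{v₃} D'] [MonoidalCategory D']

open Functor.LaxMonoidal Functor.Monoidal

/-- The map `g : F M ⟶ Z` is compatible with `m : T ⊗ M ⟶ M` and `a : T' ⊗ Z ⟶ Z` relative to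
the map `i : F T ⟶ T'`. -/
def IsActionMap (F : C ⥤ D) [F.Monoidal] {T M : C} {T' Z : D} (i : F.obj T ⟶ T')
    (m : T ⊗ M ⟶ M) (a : T' ⊗ Z ⟶ Z) (g : F.obj M ⟶ Z) : Prop :=
  μ F T M ≫ F.map m ≫ g = i ▷ F.obj M ≫ T' ◁ g ≫ a

theorem IsActionMap.id {T M : C} (m : T ⊗ M ⟶ M) : IsActionMap (𝟭 C) (𝟙 T) m m (𝟙 M) := by
  change 𝟙 _ ≫ m ≫ 𝟙 _ = 𝟙 T ▷ M ≫ T ◁ 𝟙 M ≫ m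
  simp

theorem IsActionMap.comp {F : C ⥤ D} [F.Monoidal] {G : D ⥤ D'} [G.Monoidal] {T M : C}
    {T' M' : D} {T'' Z : D'} {i : F.obj T ⟶ T'} {m : T ⊗ M ⟶ M} {m' : T' ⊗ M' ⟶ M'}
    {g : F.obj M ⟶ M'} (h : IsActionMap F i m m' g) {i' : G.obj T' ⟶ T''} {a : T'' ⊗ Z ⟶ Z}
    {g' : G.obj M' ⟶ Z} (h' : IsActionMap G i' m' a g') :
    IsActionMap (F ⋙ G) (G.map i ≫ i') m a (G.map g ≫ g') := by
  unfold IsActionMap at *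
  have h₁ := congrArg G.map h
  simp only [Functor.map_comp] at h₁
  change (μ G _ _ ≫ G.map (μ F T M)) ≫ G.map (F.map m) ≫ G.map g ≫ g' =
    (G.map i ≫ i') ▷ G.obj (F.obj M) ≫ T'' ◁ (G.map g ≫ g') ≫ a
  rw [Category.assoc, reassoc_of% h₁, ← μ_natural_left_assoc, ← μ_natural_right_assoc, h']
  simp [whisker_exchange_assoc]

/-- The image of `m : T ⊗ M ⟶ M` and `u : 𝟙_ ⟶ M` under a strong monoidal functor `F` is the free
algebra on the unit for the pointed endofunctor `T' ⊗ (-)`, where `i : F T ≅ T'`. -/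
def IsFreeImage (F : C ⥤ D) [F.Monoidal] {T M : C} {T' : D} (i : F.obj T ⟶ T') (η' : 𝟙_ D ⟶ T')
    (m : T ⊗ M ⟶ M) (u : 𝟙_ C ⟶ M) : Prop :=
  ∀ (Z : D) (a : T' ⊗ Z ⟶ Z), ((λ_ Z).inv ≫ η' ▷ Z) ≫ a = 𝟙 Z → ∀ z : 𝟙_ D ⟶ Z,
    ∃! g : F.obj M ⟶ Z, IsActionMap F i m a g ∧ ε F ≫ F.map u ≫ g = z

section

variable {F : C ⥤ D} [F.Monoidal] {T M : C} {η : 𝟙_ C ⟶ T} {m : T ⊗ M ⟶ M}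
  {T' M' : D} {i : F.obj T ≅ T'} {η' : 𝟙_ D ⟶ T'}

/-- The image `F M` is an algebra for `T' ⊗ (-)`, by transporting `F m` along `i` and the monoidal
constraint. -/
theorem unit_map (hi : ε F ≫ F.map η ≫ i.hom = η') (hm : ((λ_ M).inv ≫ η ▷ M) ≫ m = 𝟙 M) :
    ((λ_ (F.obj M)).inv ≫ η' ▷ F.obj M) ≫ i.inv ▷ F.obj M ≫ μ F T M ≫ F.map m = 𝟙 _ := by
  have e : η' ▷ F.obj M ≫ i.inv ▷ F.obj M = ε F ▷ F.obj M ≫ F.map η ▷ F.obj M := by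
    rw [← comp_whiskerRight, ← comp_whiskerRight, ← hi]
    simp
  rw [Category.assoc, reassoc_of% e, μ_natural_left_assoc, ← F.map_comp]
  rw [Category.assoc, Iso.inv_comp_eq, Category.comp_id] at hm
  rw [hm, Iso.inv_comp_eq, Category.comp_id, left_unitality]

/-- `F M` and `M'` are both free algebras on the unit for `T' ⊗ (-)`, so the two extensions of the
units are mutually inverse. -/
theorem IsFreeImage.exists_iso {u : 𝟙_ C ⟶ M} (hF : IsFreeImage F i.hom η' m u)
    {m' : T' ⊗ M' ⟶ M'} {u' : 𝟙_ D ⟶ M'} (hM' : IsFreeAction η' m' u')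
    (hi : ε F ≫ F.map η ≫ i.hom = η') (hm : ((λ_ M).inv ≫ η ▷ M) ≫ m = 𝟙 M) :
    ∃ e : F.obj M ≅ M', IsActionMap F i.hom m m' e.hom ∧ ε F ≫ F.map u ≫ e.hom = u' := by
  obtain ⟨g, h₁, h₂⟩ := (hF M' m' hM'.unit_str u').exists
  have hs := unit_map hi hm
  obtain ⟨k, h₃, h₄⟩ := hM'.exists_extension_unit hs (ε F ≫ F.map u)
  have h₅ : i.inv ▷ F.obj M ≫ μ F T M ≫ F.map m ≫ g = T' ◁ g ≫ m' := by
    rw [h₁, ← comp_whiskerRight_assoc, i.inv_hom_id, id_whiskerRight, Category.id_comp]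
  refine ⟨⟨g, k, ?_, ?_⟩, h₁, h₂⟩
  · refine (hF _ _ hs (ε F ≫ F.map u)).unique ⟨?_, ?_⟩ ⟨?_, ?_⟩
    · unfold IsActionMap at *
      rw [reassoc_of% h₁, h₃]
      simp
    · rw [reassoc_of% h₂, h₄]
    · unfold IsActionMap
      rw [Category.comp_id, MonoidalCategory.whiskerLeft_id, Category.id_comp,
        ← comp_whiskerRight_assoc, i.hom_inv_id, id_whiskerRight, Category.id_comp]
    · rw [Category.comp_id]
  · apply hM'.hom_ext_unit hM'.unit_str
    · rw [reassoc_of% h₃, h₅]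
      simp
    · simp
    · rw [reassoc_of% h₄, h₂, Category.comp_id]

variable [MonObj M] [MonObj M'] {ι : T ⟶ M} {ι' : T' ⟶ M'}

/-- `ι` is the action applied to the unit (`one_mul_eq`), and `e` respects both. -/
theorem map_comp_of_isActionMap {e : F.obj M ⟶ M'}
    (h : IsActionMap F i.hom (ι ▷ M ≫ MonObj.mul) (ι' ▷ M' ≫ MonObj.mul) e)
    (h' : ε F ≫ F.map MonObj.one ≫ e = MonObj.one) : F.map ι ≫ e = i.hom ≫ ι' := by
  unfold IsActionMap at h
  have e₁ : F.map (ρ_ T).inv = (ρ_ _).inv ≫ F.obj T ◁ ε F ≫ μ F T (𝟙_ C) := by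
    simp
  rw [← IsFreeAction.one_mul_eq ι, F.map_comp, F.map_comp, Category.assoc, Category.assoc, e₁,
    Category.assoc, Category.assoc, ← μ_natural_right_assoc, h, whisker_exchange_assoc,
    whisker_exchange_assoc, ← MonoidalCategory.whiskerLeft_comp_assoc,
    ← MonoidalCategory.whiskerLeft_comp_assoc, Category.assoc, h',
    ← rightUnitor_inv_naturality_assoc, IsFreeAction.one_mul_eq]

theorem mul_of_isActionMap {e : F.obj M ≅ M'}
    (hM' : IsFreeAction η' (ι' ▷ M' ≫ MonObj.mul) MonObj.one)
    (h : IsActionMap F i.hom (ι ▷ M ≫ MonObj.mul) (ι' ▷ M' ≫ MonObj.mul) e.hom)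
    (h' : ε F ≫ F.map MonObj.one ≫ e.hom = MonObj.one) :
    μ F M M ≫ F.map MonObj.mul ≫ e.hom = (e.hom ⊗ₘ e.hom) ≫ MonObj.mul := by
  unfold IsActionMap at h
  have hse : (i.inv ▷ F.obj M ≫ μ F T M ≫ F.map (ι ▷ M ≫ MonObj.mul)) ≫ e.hom =
      T' ◁ e.hom ≫ ι' ▷ M' ≫ MonObj.mul := by
    rw [Category.assoc, Category.assoc, h, ← comp_whiskerRight_assoc, i.inv_hom_id,
      id_whiskerRight, Category.id_comp]
  have hinv : (ι' ▷ M' ≫ MonObj.mul) ≫ e.inv =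
      T' ◁ e.inv ≫ i.inv ▷ F.obj M ≫ μ F T M ≫ F.map (ι ▷ M ≫ MonObj.mul) := by
    rw [Iso.comp_inv_eq, Category.assoc, hse, ← MonoidalCategory.whiskerLeft_comp_assoc,
      e.inv_hom_id, MonoidalCategory.whiskerLeft_id, Category.id_comp]
  have hs : (i.inv ▷ F.obj M ≫ μ F T M ≫ F.map (ι ▷ M ≫ MonObj.mul)) ▷ F.obj M ≫
      μ F M M ≫ F.map MonObj.mul = (α_ _ _ _).hom ≫ T' ◁ (μ F M M ≫ F.map MonObj.mul) ≫
        i.inv ▷ F.obj M ≫ μ F T M ≫ F.map (ι ▷ M ≫ MonObj.mul) := by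
    rw [comp_whiskerRight_assoc, comp_whiskerRight_assoc, μ_natural_left_assoc, ← F.map_comp,
      IsFreeAction.mul_mul, F.map_comp, F.map_comp, associativity_assoc,
      ← μ_natural_right_assoc, whisker_exchange_assoc]
    simp
  have hone : (MonObj.one : 𝟙_ D ⟶ M') ≫ e.inv = ε F ≫ F.map MonObj.one := by
    rw [← h']
    simp
  -- The multiplication of `F M` transported to `M'` and that of `M'` are both algebra maps out of
  -- `M' ⊗ M'`, the free algebra on `M'`, and both satisfy the left unit law.
  have key : (e.inv ⊗ₘ e.inv) ≫ μ F M M ≫ F.map MonObj.mul ≫ e.hom = MonObj.mul := by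
    apply hM'.hom_ext hM'.unit_str
    · rw [MonoidalCategory.tensorHom_def, Category.assoc, ← comp_whiskerRight_assoc, hinv,
        comp_whiskerRight_assoc, ← whisker_exchange_assoc (g := e.inv), reassoc_of% hs]
      simp only [Category.assoc] at hse
      rw [hse]
      simp
    · exact IsFreeAction.mul_mul ι'
    · rw [MonoidalCategory.tensorHom_def, Category.assoc, ← comp_whiskerRight_assoc, hone,
        comp_whiskerRight_assoc, ← whisker_exchange_assoc (g := e.inv),
        ← whisker_exchange_assoc (g := e.inv), μ_natural_left_assoc, ← F.map_comp_assoc,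
        MonObj.one_mul, ← left_unitality_assoc, leftUnitor_naturality_assoc, e.inv_hom_id,
        MonObj.one_mul, Category.comp_id]
  rw [← key, tensorHom_comp_tensorHom_assoc]
  simp

end

end

/-! ## The free monoid on the pointed object of a configuration -/

section

open Functor.LaxMonoidal Functor.OplaxMonoidal Functor.Monoidal

variable {κ : Ordinal.{w}}

/-- The functor `(-) ⊗ A` commutes with `T ⊗ (-)`. -/
def tensorRightComm {E : Type u₁} [Category.{v₁} E] [MonoidalCategory E] {T : E} (η : 𝟙_ E ⟶ T)
    (A : E) : (tensorPointed T η).toFunctor ⋙ tensorRight A ≅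
      tensorRight A ⋙ (tensorPointed T η).toFunctor :=
  NatIso.ofComponents (fun Z => α_ T Z A) (fun f => associator_naturality_middle T f A)

/-- A strong monoidal functor commutes with the functors `T ⊗ (-)` and `T' ⊗ (-)`, where
`T'` is the image of `T`. -/
def tensorLeftComm {C : Type u₁} [Category.{v₁} C] [MonoidalCategory C] {D : Type u₂}
    [Category.{v₂} D] [MonoidalCategory D] (F : C ⥤ D) [F.Monoidal] {T : C} (η : 𝟙_ C ⟶ T)
    {T' : D} (η' : 𝟙_ D ⟶ T') (i : F.obj T ≅ T') :
    (tensorPointed T η).toFunctor ⋙ F ≅ F ⋙ (tensorPointed T' η').toFunctor :=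
  NatIso.ofComponents (fun Z => (μIso F T Z).symm ≪≫ whiskerRightIso i (F.obj Z)) (fun f => by
    change F.map (T ◁ f) ≫ δ F T _ ≫ i.hom ▷ _ = (δ F T _ ≫ i.hom ▷ _) ≫ T' ◁ F.map f
    rw [Category.assoc, ← whisker_exchange, δ_natural_right_assoc])

/-- One free algebra on the unit is used twice. Its image under `(-) ⊗ A` is free on `𝟙_ ⊗ A ≅ A`,
and its image under a map of configurations is free on `F 𝟙_ ≅ 𝟙_`. Each functor commutes with
tensoring on the left, by the associator or by the monoidal constraint. -/
theorem ConfMon.exists_isFreeAction (hκ : IsRegularOrdinal κ) (X : ConfMon.{w, v, u} κ) :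
    ∃ (M : X.toMonoidalCat.carrier) (m : X.pt ⊗ M ⟶ M) (u : 𝟙_ X.toMonoidalCat.carrier ⟶ M),
      IsFreeAction X.unit m u ∧ ∀ (Y : ConfMon.{w, v, u} κ) (f : X ⟶ Y),
        IsFreeImage f.toHom.functor f.iso.hom Y.unit m u := by
  obtain ⟨⟨M, m, hm⟩, u, hB⟩ := PointedEndofunctor.exists_isFreeAlgebra.{w, v, u, v, u} hκ
    X.isConfiguration (𝟙_ X.toMonoidalCat.carrier)
  refine ⟨M, m, u, ⟨hm, fun A Z a ha f => ?_⟩, fun Y f Z a ha z => ?_⟩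
  · have h := hB X.isConfiguration (tensorRight A) (X.tensorRight_isExactMap A)
      (tensorRightComm X.unit A) (fun Z => by
        change ((λ_ Z).inv ≫ X.unit ▷ Z) ▷ A ≫ (α_ X.pt Z A).hom =
          (λ_ (Z ⊗ A)).inv ≫ X.unit ▷ (Z ⊗ A)
        simp)
    have h' : ∃! g : M ⊗ A ⟶ Z, ((α_ X.pt M A).inv ≫ m ▷ A) ≫ g = X.pt ◁ g ≫ a ∧
      u ▷ A ≫ g = (λ_ A).hom ≫ f := h ⟨Z, a, ha⟩ ((λ_ A).hom ≫ f)
    obtain ⟨g, ⟨h₁, h₂⟩, hg⟩ := h'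
    refine ⟨g, ⟨h₁, ?_⟩, fun g' ⟨h₁', h₂'⟩ => hg g' ⟨h₁', ?_⟩⟩
    · rw [Category.assoc, h₂, Iso.inv_hom_id_assoc]
    · rw [← h₂', Category.assoc, Iso.hom_inv_id_assoc]
  · let F := f.toHom.functor
    have h := hB Y.isConfiguration F f.isExactMap (tensorLeftComm F X.unit Y.unit f.iso)
      (fun Z => by
        change F.map ((λ_ Z).inv ≫ X.unit ▷ Z) ≫ δ F X.pt Z ≫ f.iso.hom ▷ F.obj Z =
          (λ_ (F.obj Z)).inv ≫ Y.unit ▷ F.obj Z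
        rw [← f.isPointedIso]
        change _ = (λ_ (F.obj Z)).inv ≫ (ε F ≫ F.map X.unit ≫ f.iso.hom) ▷ F.obj Z
        simp)
    have h' : ∃! g : F.obj M ⟶ Z, ((f.iso.inv ▷ F.obj M ≫ μ F X.pt M) ≫ F.map m) ≫ g =
      Y.pt ◁ g ≫ a ∧ F.map u ≫ g = (εIso F).inv ≫ z := h ⟨Z, a, ha⟩ ((εIso F).inv ≫ z)
    have e (x : F.obj X.pt ⊗ F.obj M ⟶ Z) (y : Y.pt ⊗ F.obj M ⟶ Z) :
        f.iso.inv ▷ F.obj M ≫ x = y ↔ x = f.iso.hom ▷ F.obj M ≫ y :=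
      (whiskerRightIso f.iso (F.obj M)).inv_comp_eq
    simp only [Category.assoc, e, Iso.eq_inv_comp] at h'
    exact h'

/-- A free monoid on the pointed object of a configuration that is obtained from a free algebra
preserved by maps of configurations. -/
structure ConfMon.FreeMonoidData (X : ConfMon.{w, v, u} κ) where
  monoid : X.toMonoidalCat.carrier
  [monObj : MonObj monoid]
  ι : X.pt ⟶ monoid
  pointed : X.unit ≫ ι = MonObj.one
  isFreeAction : IsFreeAction X.unit (ι ▷ monoid ≫ MonObj.mul) MonObj.one
  isFreeImage : ∀ {Y : ConfMon.{w, v, u} κ} (f : X ⟶ Y),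
    IsFreeImage f.toHom.functor f.iso.hom Y.unit (ι ▷ monoid ≫ MonObj.mul) MonObj.one

attribute [instance] ConfMon.FreeMonoidData.monObj

theorem ConfMon.nonempty_freeMonoidData (hκ : IsRegularOrdinal κ) (X : ConfMon.{w, v, u} κ) :
    Nonempty X.FreeMonoidData := by
  obtain ⟨M, m, u, h, h'⟩ := X.exists_isFreeAction hκ
  obtain ⟨_, ι, rfl, rfl, hι⟩ := h.exists_monObj
  exact ⟨⟨M, ι, hι, h, fun f => h' _ f⟩⟩

namespace ConfMon.FreeMonoidData

variable {X Y Z : ConfMon.{w, v, u} κ} (dX : X.FreeMonoidData) (dY : Y.FreeMonoidData)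
  (dZ : Z.FreeMonoidData)

theorem exists_iso (f : X ⟶ Y) : ∃ e : f.toHom.functor.obj dX.monoid ≅ dY.monoid,
    IsActionMap f.toHom.functor f.iso.hom (dX.ι ▷ dX.monoid ≫ MonObj.mul)
      (dY.ι ▷ dY.monoid ≫ MonObj.mul) e.hom ∧
    ε f.toHom.functor ≫ f.toHom.functor.map MonObj.one ≫ e.hom = MonObj.one :=
  (dX.isFreeImage f).exists_iso dY.isFreeAction f.isPointedIso dX.isFreeAction.unit_str

/-- The comparison of free monoids induced by a map of configurations. -/
noncomputable def iso (f : X ⟶ Y) : f.toHom.functor.obj dX.monoid ≅ dY.monoid :=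
  (exists_iso dX dY f).choose

theorem isActionMap_iso (f : X ⟶ Y) : IsActionMap f.toHom.functor f.iso.hom
    (dX.ι ▷ dX.monoid ≫ MonObj.mul) (dY.ι ▷ dY.monoid ≫ MonObj.mul) (iso dX dY f).hom :=
  (exists_iso dX dY f).choose_spec.1

theorem one_iso (f : X ⟶ Y) : ε f.toHom.functor ≫ f.toHom.functor.map MonObj.one ≫
    (iso dX dY f).hom = MonObj.one :=
  (exists_iso dX dY f).choose_spec.2

theorem isMonoidIso (f : X ⟶ Y) : IsMonoidIso f.toHom dX.monoid dY.monoid (iso dX dY f) where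
  one := one_iso dX dY f
  mul := mul_of_isActionMap dY.isFreeAction (isActionMap_iso dX dY f) (one_iso dX dY f)

theorem map_ι_iso (f : X ⟶ Y) :
    f.toHom.functor.map dX.ι ≫ (iso dX dY f).hom = f.iso.hom ≫ dY.ι :=
  map_comp_of_isActionMap (isActionMap_iso dX dY f) (one_iso dX dY f)

/-- The comparison was chosen, but it is determined by the action and the unit. Functoriality
follows, since identities and composites satisfy the same two conditions. -/
theorem iso_hom_eq {f : X ⟶ Y} {g : f.toHom.functor.obj dX.monoid ⟶ dY.monoid}
    (h : IsActionMap f.toHom.functor f.iso.hom (dX.ι ▷ dX.monoid ≫ MonObj.mul)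
      (dY.ι ▷ dY.monoid ≫ MonObj.mul) g)
    (h' : ε f.toHom.functor ≫ f.toHom.functor.map MonObj.one ≫ g = MonObj.one) :
    (iso dX dY f).hom = g :=
  (dX.isFreeImage f _ _ dY.isFreeAction.unit_str MonObj.one).unique
    ⟨isActionMap_iso dX dY f, one_iso dX dY f⟩ ⟨h, h'⟩

theorem iso_id : (iso dX dX (𝟙 X)).hom = 𝟙 dX.monoid :=
  iso_hom_eq dX dX (IsActionMap.id _) (IsMonoidIso.id _ dX.monoid).one

theorem iso_comp (f : X ⟶ Y) (g : Y ⟶ Z) : (iso dX dZ (f ≫ g)).hom =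
    g.toHom.functor.map (iso dX dY f).hom ≫ (iso dY dZ g).hom :=
  iso_hom_eq dX dZ ((isActionMap_iso dX dY f).comp (isActionMap_iso dY dZ g))
    ((isMonoidIso dX dY f).comp (isMonoidIso dY dZ g)).one

end ConfMon.FreeMonoidData

/-- The lift of the canonical functor given by the free monoids on the pointed objects. -/
noncomputable def freeMonoidLift (d : ∀ X : ConfMon.{w, v, u} κ, X.FreeMonoidData) :
    MonoidLift.{w, v, u} κ where
  monoid X := (d X).monoid
  monObj X := (d X).monObj
  iso f := (d _).iso (d _) f
  isMonoidIso f := (d _).isMonoidIso (d _) f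
  iso_id X := (d X).iso_id
  iso_comp f g := (d _).iso_comp (d _) (d _) f g

end

end FreeMonoidSequence

theorem mainTheorem7 (κ : Ordinal.{w}) (hκ : FreeMonoidSequence.IsRegularOrdinal κ) :
    ∃ (Φ : FreeMonoidSequence.MonoidLift.{w, v, u} κ)
      (ι : ∀ X : FreeMonoidSequence.ConfMon.{w, v, u} κ, X.pt ⟶ Φ.monoid X),
      -- the functor given by `Φ` is a lift of the canonical functor
      Φ.toFunctor ⋙ FreeMonoidSequence.projection = FreeMonoidSequence.forget κ ∧
      -- its value is the free and algebraically-free monoid on the pointed object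
      (∀ X : FreeMonoidSequence.ConfMon.{w, v, u} κ,
        FreeMonoidSequence.IsFreeMonoid X.unit (Φ.monoid X) (ι X) ∧
        FreeMonoidSequence.IsAlgebraicallyFreeMonoid X.unit (Φ.monoid X) (ι X)) ∧
      -- the action on maps is compatible with the universal maps
      (∀ {X Y : FreeMonoidSequence.ConfMon.{w, v, u} κ} (f : X ⟶ Y),
        f.toHom.functor.map (ι X) ≫ (Φ.iso f).hom = f.iso.hom ≫ ι Y) ∧
      -- the monoid is the free monad on `T ⊗ (-)` applied to the unit
      (∀ X : FreeMonoidSequence.ConfMon.{w, v, u} κ,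
        ∃ (R : Monad X.toMonoidalCat.carrier)
          (σ : (FreeMonoidSequence.tensorPointed X.pt X.unit).MapToMonad R),
          FreeMonoidSequence.IsFreeMonad σ ∧ FreeMonoidSequence.IsAlgebraicallyFreeMonad σ ∧
          ∃ (φ : FreeMonoidSequence.tensorMonad (Φ.monoid X) ≅ R)
            (e : Φ.monoid X ≅ R.obj (𝟙_ X.toMonoidalCat.carrier)),
            (∀ A : X.toMonoidalCat.carrier, ι X ▷ A ≫ φ.hom.app A = σ.toNatTrans.app A) ∧
            e.hom = (ρ_ (Φ.monoid X)).inv ≫ φ.hom.app (𝟙_ X.toMonoidalCat.carrier)) := by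
  let d (X : FreeMonoidSequence.ConfMon.{w, v, u} κ) : X.FreeMonoidData :=
    (X.nonempty_freeMonoidData hκ).some
  have hv (X : FreeMonoidSequence.ConfMon.{w, v, u} κ) :=
    (d X).isFreeAction.freeValues (d X).pointed
  refine ⟨FreeMonoidSequence.freeMonoidLift d, fun X => (d X).ι, rfl, fun X => ⟨?_, ?_⟩,
    fun {X Y} f => ?_, fun X => ?_⟩
  · exact (d X).isFreeAction.isFreeMonoid (d X).pointed
  · exact FreeMonoidSequence.isAlgebraicallyFreeMonoid_of_freeValues (hv X)
  · exact (d X).map_ι_iso (d Y) f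
  -- The monad `M ⊗ (-)` is itself the free monad, because its values are free algebras; `φ` is the
  -- identity and `e` the right unitor.
  · refine ⟨FreeMonoidSequence.tensorMonad (d X).monoid,
      FreeMonoidSequence.tensorMapToMonad (d X).pointed, (hv X).isFreeMonad,
      (hv X).isAlgebraicallyFreeMonad, Iso.refl _, (ρ_ (d X).monoid).symm, fun A => ?_, ?_⟩
    · exact Category.comp_id _
    · exact (Category.comp_id _).symm
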